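/- Consider arms that are Gilbert--Elliot channels: an arm has a two-state (good $=1$, bad $=0$) Markov chain with transition probabilities $p_{11}=\Pr(1\to1)$, $p_{01}=\Pr(0\to1)$ in $[0,1]$, and a transmission rate $B>0$. Its state for the decision maker is the belief $\omega\in[0,1]$ that the channel is good. If the arm is activated at belief $\omega$, the expected reward is $\omega B$ and the next belief is $p_{11}$ with probability $\omega$ and $p_{01}$ with probability $1-\omega$. If it is passive, the next belief is $\mathcal T(\omega)=\omega p_{11}+(1-\omega)p_{01}$. Fix a discount factor $0\le\beta<1$. For $m\in\mathbb R$, let $V_{\beta,m}(\omega)$ be the maximal expected total discounted reward, over policies mapping beliefs to actions, of the single arm with an extra subsidy $m$ in each passive slot. The passive set is $$\mathcal P(m)=\{\omega\in[0,1]:\ m+\beta V_{\beta,m}(\mathcal T(\omega))\ge \omega B+\beta(\omega V_{\beta,m}(p_{11})+(1-\omega)V_{\beta,m}(p_{01}))\},$$ and Whittle's index is $W_\beta(\omega)=\inf\{m\in\mathbb R:\omega\in\mathcal P(m)\}$. Let $\omega_o=\frac{p_{01}}{p_{01}+1-p_{11}}$ be the stationary probability of the good state (take $\omega_o=0$ if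 $p_{01}=0$ and $p_{11}=1$). Then: 1. Every arm is indexable (that is, $\mathcal P(m)$ is increasing in $m$, with $\bigcap_m\mathcal P(m)=\emptyset$ and $\bigcup_m\mathcal P(m)=[0,1]$, so that $W_\beta$ is well defined), and $W_\beta$ is a strictly increasing function of $\omega$ on $[0,1]$. As a consequence, for $N$ stochastically identical arms (same $p_{11},p_{01},B$), of which $K\le N$ are activated in each slot, Whittle's index policy is equivalent to the myopic policy: a map $\pi$ from belief vectors $(\omega_1,\dots,\omega_N)\in[0,1]^N$ to sets of arms always selects $K$ arms with the largest Whittle indices if and only if it always selects a set $U$ that maximizes $\sum_{i\in U}\omega_iB$ among all sets of $K$ arms. 2. If $p_{11}\ge p_{01}$, then $W_\beta$ is piecewise concave on $[0,1]$ with countably many pieces. More specifically, $W_\beta$ is linear on $[0,p_{01}]$ and on $[p_{11},1]$, concave on $[\omega_o,p_{11})$, and piecewise concave with countably many pieces on $(p_{01},\omega_o)$. 3. If $p_{11}<p_{01}$, then $W_\beta$ is piecewise convex on $[0,1]$ with finitely many pieces. More specifically, $W_\beta$ is linear on $[0,p_{11}]$ and on $[p_{01},1]$, and convex on each of $(p_{11},\omega_o)$,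 $[\omega_o,\mathcal T(p_{11}))$ and $[\mathcal T(p_{11}),p_{01})$. Here "piecewise concave (convex) on $S$ with countably (finitely) many pieces" means that $S$ is a disjoint union of countably (finitely) many intervals, on each of which the function is concave (convex). -/

import Mathlib

noncomputable section

/-- A restless arm: a Gilbert-Elliot channel with states `1` (good) and `0` (bad), transition
probabilities `p11 = Pr(1 → 1)` and `p01 = Pr(0 → 1)`, and transmission rate `B > 0`. -/
structure Arm where
  p11 : unitInterval
  p01 : unitInterval
  B : ℝ
  B_pos : 0 < B

namespace Arm

/-- One-step update `ω p11 + (1 - ω) p01` of the belief of an unobserved arm. -/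
def update (a : Arm) (ω : unitInterval) : unitInterval :=
  ⟨ω * a.p11 + (1 - ω) * a.p01, by
    have h0 := ω.2.1
    have h1 := ω.2.2
    have h2 := a.p11.2.1
    have h3 := a.p11.2.2
    have h4 := a.p01.2.1
    have h5 := a.p01.2.2
    constructor
    · have := mul_nonneg h0 h2
      have := mul_nonneg (sub_nonneg.2 h1) h4
      linarith
    · have := mul_le_mul_of_nonneg_left h3 h0
      have := mul_le_mul_of_nonneg_left h5 (sub_nonneg.2 h1)
      linarith⟩

/-- The stationary probability `p01 / (p01 + p10)` of the good state, where `p10 = 1 - p11`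
(it is `0` for the arm with `p01 = 0` and `p11 = 1`, whose state never changes). -/
def stationary (a : Arm) : ℝ := (a.p01 : ℝ) / ((a.p01 : ℝ) + (1 - (a.p11 : ℝ)))

/-- Law of the channel state (`true` is good) when the belief is `ω`. -/
def stateLaw (ω : unitInterval) : PMF Bool :=
  PMF.ofFintype (fun s => cond s (ENNReal.ofReal ω) (ENNReal.ofReal (1 - ω))) (by
    have h0 := ω.2.1
    have h1 := ω.2.2
    rw [Fintype.sum_bool, cond_true, cond_false, ← ENNReal.ofReal_add h0 (sub_nonneg.2 h1)]
    simp)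

/-- Law of the next belief when action `u` (`true` is active, `false` is passive) is taken at
belief `ω`: an active arm is observed, a passive arm is not. -/
def transition (a : Arm) (ω : unitInterval) (u : Bool) : PMF unitInterval :=
  if u then (stateLaw ω).map (fun s => cond s a.p11 a.p01) else PMF.pure (a.update ω)

/-- Expected reward earned in a slot in which action `u` is taken at belief `ω`, in the
single-armed bandit process with subsidy `m` for passivity. -/
def reward (a : Arm) (m : ℝ) (ω : unitInterval) (u : Bool) : ℝ := if u then ω * a.B else m

/-- Law of the belief after `t` slots, from initial belief `ω`, under the policy `π`. -/
def beliefLaw (a : Arm) (π : unitInterval → Bool) : ℕ → unitInterval → PMF unitInterval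
  | 0, ω => PMF.pure ω
  | t + 1, ω => (a.transition ω (π ω)).bind (beliefLaw a π t)

/-- Expected reward in the slot that follows the first `t` slots (the law of the belief in that
slot has finite support). -/
def expectedReward (a : Arm) (m : ℝ) (π : unitInterval → Bool) (ω : unitInterval) (t : ℕ) : ℝ :=
  ∑' x : unitInterval, (a.beliefLaw π t ω x).toReal * a.reward m x (π x)

/-- Expected total discounted reward of the policy `π` from initial belief `ω`. -/
def totalReward (a : Arm) (β m : ℝ) (π : unitInterval → Bool) (ω : unitInterval) : ℝ :=
  ∑' t : ℕ, β ^ t * a.expectedReward m π ω t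

/-- The value function of the single-armed bandit process with subsidy `m`. -/
def value (a : Arm) (β m : ℝ) (ω : unitInterval) : ℝ := ⨆ π : unitInterval → Bool, a.totalReward β m π ω

/-- Total reward of being passive in the first slot and optimal in all later slots. -/
def valuePassive (a : Arm) (β m : ℝ) (ω : unitInterval) : ℝ := m + β * a.value β m (a.update ω)

/-- Total reward of being active in the first slot and optimal in all later slots. -/
def valueActive (a : Arm) (β m : ℝ) (ω : unitInterval) : ℝ :=
  ω * a.B + β * (ω * a.value β m a.p11 + (1 - ω) * a.value β m a.p01)

/-- The passive set under subsidy `m`. -/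
def passiveSet (a : Arm) (β m : ℝ) : Set unitInterval :=
  {ω | a.valueActive β m ω ≤ a.valuePassive β m ω}

/-- The passive set increases monotonically from `∅` to the whole state space as the subsidy
increases from `-∞` to `+∞`. -/
def Indexable (a : Arm) (β : ℝ) : Prop :=
  Monotone (a.passiveSet β) ∧ (⋂ m : ℝ, a.passiveSet β m) = ∅ ∧
    (⋃ m : ℝ, a.passiveSet β m) = Set.univ

/-- Whittle's index of the belief state `ω`. -/
def whittleIndex (a : Arm) (β : ℝ) (ω : unitInterval) : ℝ := sInf {m : ℝ | ω ∈ a.passiveSet β m}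

/-- Whittle's index as a function of a real variable; only its values on `[0, 1]` matter. -/
def whittleIndexReal (a : Arm) (β : ℝ) (x : ℝ) : ℝ :=
  a.whittleIndex β (Set.projIcc 0 1 zero_le_one x)

end Arm

/-- `U` consists of `K` arms with the largest indices. -/
def IsTopSet {N : ℕ} (K : ℕ) (index : Fin N → ℝ) (U : Finset (Fin N)) : Prop :=
  U.card = K ∧ ∀ i ∈ U, ∀ j ∉ U, index j ≤ index i

/-- `π` is a Whittle index policy: in every belief state it activates `K` arms whose current
states have the largest Whittle indices (ties are broken in any way). -/
def IsWhittlePolicy {N : ℕ} (arms : Fin N → Arm) (K : ℕ) (β : ℝ)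
    (π : (Fin N → unitInterval) → Finset (Fin N)) : Prop :=
  ∀ Ω : Fin N → unitInterval, IsTopSet K (fun i => (arms i).whittleIndex β (Ω i)) (π Ω)

/-- `π` is a myopic policy: in every belief state it activates a set of `K` arms that maximizes
the expected immediate reward (ties are broken in any way). -/
def IsMyopicPolicy {N : ℕ} (arms : Fin N → Arm) (K : ℕ)
    (π : (Fin N → unitInterval) → Finset (Fin N)) : Prop :=
  ∀ Ω : Fin N → unitInterval, (π Ω).card = K ∧ ∀ U : Finset (Fin N), U.card = K →
    ∑ i ∈ U, (Ω i : ℝ) * (arms i).B ≤ ∑ i ∈ π Ω, (Ω i : ℝ) * (arms i).B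

/-- `f` is linear on `s`. -/
def LinearOnSet (f : ℝ → ℝ) (s : Set ℝ) : Prop := ∃ c : ℝ, ∀ x ∈ s, f x = c * x

/-- `s` splits into countably many disjoint intervals on each of which `f` is concave
(`ConcaveOn` contains the convexity of the piece). -/
def PiecewiseConcaveOnCountable (f : ℝ → ℝ) (s : Set ℝ) : Prop :=
  ∃ P : Set (Set ℝ), P.Countable ∧ P.PairwiseDisjoint id ∧ ⋃₀ P = s ∧
    ∀ J ∈ P, ConcaveOn ℝ J f

/-- `s` splits into finitely many disjoint intervals on each of which `f` is convex. -/
def PiecewiseConvexOnFinite (f : ℝ → ℝ) (s : Set ℝ) : Prop :=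
  ∃ P : Set (Set ℝ), P.Finite ∧ P.PairwiseDisjoint id ∧ ⋃₀ P = s ∧
    ∀ J ∈ P, ConvexOn ℝ J f

end

noncomputable section

/-! The index is found by solving for the subsidy that makes both actions optimal. Write D_m(ω) for
the passive value minus the active value. The value function is convex in the belief
(`convexBelief_value`) and the active value is affine, so D_m is convex, with D_m(0) = m and D_m(1)
= m - B. If D_m(ω) = 0 for some ω < 1, then 0 ≤ m < B, and convexity with D_m(1) < 0 makes ω a
threshold: passive below it, active above (`isThreshold_of_advantage_eq_zero`).

For a threshold policy, the values at p11, p01 and T(ω) solve a small linear system. Its shape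
depends only on how ω lies relative to p11, p01, T(ω) and the passive orbit that starts at p01 or
p11. Eliminating the values leaves m * d = n with d > 0, where n and d are affine in ω on each
region and free of m (the `subsidy_of_...` lemmas). Hence m is unique (`advantage_root_unique`). As
D_m(ω) is continuous in m, negative for m < 0 and nonnegative for m ≥ B, it changes sign exactly
once, at Whittle's index. This gives indexability; strict positivity of D below the threshold gives
strict monotonicity.

The same equations show that the index is linear fractional on each region. Since it is increasing,
the sign of the slope of d alone decides between concave and convex (`concaveOn_of_mul_eq`,
`convexOn_of_mul_eq`). -/

namespace Arm

/-! ### Bellman operator and the discounted comparison principle -/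

/-- Expectation of `F` at the next belief. -/
def nextMean (a : Arm) (u : Bool) (F : unitInterval → ℝ) (ω : unitInterval) : ℝ :=
  if u then ω * F a.p11 + (1 - ω) * F a.p01 else F (a.update ω)

/-- Bellman operator of the single-armed bandit with subsidy `m`. -/
def bellman (a : Arm) (β m : ℝ) (F : unitInterval → ℝ) (ω : unitInterval) : ℝ :=
  max (m + β * F (a.update ω)) (ω * a.B + β * (ω * F a.p11 + (1 - ω) * F a.p01))

theorem bellman_eq_max (a : Arm) (β m : ℝ) (F : unitInterval → ℝ) (ω : unitInterval) :
    a.bellman β m F ω = max (a.reward m ω false + β * a.nextMean false F ω)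
      (a.reward m ω true + β * a.nextMean true F ω) := by
  simp [bellman, reward, nextMean]

theorem nextMean_mono (a : Arm) (u : Bool) {F G : unitInterval → ℝ} (h : ∀ x, F x ≤ G x)
    (ω : unitInterval) : a.nextMean u F ω ≤ a.nextMean u G ω := by
  have h0 := ω.2.1
  have h1 := sub_nonneg.2 ω.2.2
  unfold nextMean
  split_ifs
  · exact add_le_add (mul_le_mul_of_nonneg_left (h _) h0) (mul_le_mul_of_nonneg_left (h _) h1)
  · exact h _

theorem nextMean_const (a : Arm) (u : Bool) (c : ℝ) (ω : unitInterval) :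
    a.nextMean u (fun _ => c) ω = c := by
  unfold nextMean
  split_ifs <;> ring

theorem nextMean_sub (a : Arm) (u : Bool) (F G : unitInterval → ℝ) (ω : unitInterval) :
    a.nextMean u (fun x => F x - G x) ω = a.nextMean u F ω - a.nextMean u G ω := by
  unfold nextMean
  split_ifs <;> ring

/-- A discounted maximum principle: iterating the inequality turns the bound C into β^n * C, which
tends to 0. Applied to differences, it yields the comparisons of values with policies and with
constants below. -/
theorem nonpos_of_le_nextMean (a : Arm) {β : ℝ} (hβ0 : 0 ≤ β) (hβ1 : β < 1)
    (π : unitInterval → Bool) {F : unitInterval → ℝ} {C : ℝ} (hC : ∀ x, F x ≤ C)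
    (hF : ∀ x, F x ≤ β * a.nextMean (π x) F x) (x : unitInterval) : F x ≤ 0 := by
  have key : ∀ n : ℕ, ∀ x, F x ≤ β ^ n * C := by
    intro n
    induction n with
    | zero => simpa using hC
    | succ n ih =>
      intro x
      calc F x ≤ β * a.nextMean (π x) F x := hF x
        _ ≤ β * a.nextMean (π x) (fun _ => β ^ n * C) x :=
          mul_le_mul_of_nonneg_left (a.nextMean_mono _ ih x) hβ0
        _ = β ^ (n + 1) * C := by rw [nextMean_const]; ring
  have hlim : Filter.Tendsto (fun n : ℕ => β ^ n * C) Filter.atTop (nhds 0) := by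
    simpa using (tendsto_pow_atTop_nhds_zero_of_lt_one hβ0 hβ1).mul_const C
  exact ge_of_tendsto' hlim fun n => key n x

/-! ### Policy evaluation -/

theorem summable_toReal_mul (p : PMF unitInterval) {g : unitInterval → ℝ} {C : ℝ}
    (hg : ∀ x, |g x| ≤ C) : Summable fun x => (p x).toReal * g x := by
  have hp : Summable fun x => (p x).toReal := ENNReal.summable_toReal (by simp [p.tsum_coe])
  refine Summable.of_norm_bounded (hp.mul_right C) fun x => ?_
  rw [Real.norm_eq_abs, abs_mul, abs_of_nonneg ENNReal.toReal_nonneg]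
  exact mul_le_mul_of_nonneg_left (hg x) ENNReal.toReal_nonneg

theorem abs_tsum_toReal_mul_le (p : PMF unitInterval) {g : unitInterval → ℝ} {C : ℝ}
    (hg : ∀ x, |g x| ≤ C) : |∑' x, (p x).toReal * g x| ≤ C := by
  have hp : HasSum (fun x => (p x).toReal) 1 := by
    have h : Summable fun x => (p x).toReal := ENNReal.summable_toReal (by simp [p.tsum_coe])
    have h1 : ∑' x, (p x).toReal = 1 := by
      rw [← ENNReal.tsum_toReal_eq fun x => p.apply_ne_top x, p.tsum_coe, ENNReal.toReal_one]
    exact h1 ▸ h.hasSum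
  have h2 := tsum_of_norm_bounded (f := fun x => (p x).toReal * g x) (hp.mul_right C) fun x => by
    rw [Real.norm_eq_abs, abs_mul, abs_of_nonneg ENNReal.toReal_nonneg]
    exact mul_le_mul_of_nonneg_left (hg x) ENNReal.toReal_nonneg
  simpa using h2

theorem tsum_transition_bind (a : Arm) (u : Bool) (ω : unitInterval)
    (f : unitInterval → PMF unitInterval) {g : unitInterval → ℝ} {C : ℝ} (hg : ∀ x, |g x| ≤ C) :
    ∑' x, (((a.transition ω u).bind f) x).toReal * g x =
      a.nextMean u (fun y => ∑' x, (f y x).toReal * g x) ω := by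
  cases u with
  | false => simp [transition, nextMean]
  | true =>
    have h0 := ω.2.1
    have h1 := sub_nonneg.2 ω.2.2
    have hx : ∀ x, (((a.transition ω true).bind f) x).toReal * g x =
        ω * ((f a.p11 x).toReal * g x) + (1 - ω) * ((f a.p01 x).toReal * g x) := by
      intro x
      have : ((a.transition ω true).bind f) x =
          ENNReal.ofReal ω * f a.p11 x + ENNReal.ofReal (1 - ω) * f a.p01 x := by
        simp [transition, PMF.bind_map, PMF.bind_apply, stateLaw, PMF.ofFintype_apply]
      rw [this, ENNReal.toReal_add (ENNReal.mul_ne_top (by simp) ((f _).apply_ne_top _))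
        (ENNReal.mul_ne_top (by simp) ((f _).apply_ne_top _)), ENNReal.toReal_mul,
        ENNReal.toReal_mul, ENNReal.toReal_ofReal h0, ENNReal.toReal_ofReal h1]
      ring
    simp only [hx]
    rw [((summable_toReal_mul _ hg).mul_left _).tsum_add ((summable_toReal_mul _ hg).mul_left _),
      tsum_mul_left, tsum_mul_left]
    simp [nextMean]

theorem abs_reward_le (a : Arm) (m : ℝ) (ω : unitInterval) (u : Bool) :
    |a.reward m ω u| ≤ |m| + a.B := by
  have h0 := ω.2.1
  have h1 := ω.2.2
  have hB := a.B_pos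
  have hm := abs_nonneg m
  unfold reward
  split_ifs
  · rw [abs_of_nonneg (by positivity)]
    nlinarith
  · linarith

theorem abs_expectedReward_le (a : Arm) (m : ℝ) (π : unitInterval → Bool) (ω : unitInterval)
    (t : ℕ) : |a.expectedReward m π ω t| ≤ |m| + a.B :=
  abs_tsum_toReal_mul_le _ fun x => a.abs_reward_le m x (π x)

theorem expectedReward_zero (a : Arm) (m : ℝ) (π : unitInterval → Bool) (ω : unitInterval) :
    a.expectedReward m π ω 0 = a.reward m ω (π ω) := by
  unfold expectedReward beliefLaw
  rw [tsum_eq_single ω]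
  · simp
  · intro x hx
    simp [hx]

theorem expectedReward_succ (a : Arm) (m : ℝ) (π : unitInterval → Bool) (ω : unitInterval)
    (t : ℕ) : a.expectedReward m π ω (t + 1) =
      a.nextMean (π ω) (fun y => a.expectedReward m π y t) ω :=
  a.tsum_transition_bind (π ω) ω (a.beliefLaw π t) fun x => a.abs_reward_le m x (π x)

theorem summable_totalReward (a : Arm) {β : ℝ} (hβ0 : 0 ≤ β) (hβ1 : β < 1) (m : ℝ)
    (π : unitInterval → Bool) (ω : unitInterval) :
    Summable fun t : ℕ => β ^ t * a.expectedReward m π ω t := by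
  refine Summable.of_norm_bounded
    ((summable_geometric_of_lt_one hβ0 hβ1).mul_right (|m| + a.B)) fun t => ?_
  rw [Real.norm_eq_abs, abs_mul, abs_of_nonneg (pow_nonneg hβ0 t)]
  exact mul_le_mul_of_nonneg_left (a.abs_expectedReward_le m π ω t) (pow_nonneg hβ0 t)

theorem abs_totalReward_le (a : Arm) {β : ℝ} (hβ0 : 0 ≤ β) (hβ1 : β < 1) (m : ℝ)
    (π : unitInterval → Bool) (ω : unitInterval) :
    |a.totalReward β m π ω| ≤ (1 - β)⁻¹ * (|m| + a.B) := by
  refine tsum_of_norm_bounded (f := fun t : ℕ => β ^ t * a.expectedReward m π ω t)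
    ((hasSum_geometric_of_lt_one hβ0 hβ1).mul_right (|m| + a.B)) fun t => ?_
  rw [Real.norm_eq_abs, abs_mul, abs_of_nonneg (pow_nonneg hβ0 t)]
  exact mul_le_mul_of_nonneg_left (a.abs_expectedReward_le m π ω t) (pow_nonneg hβ0 t)

theorem totalReward_eq (a : Arm) {β : ℝ} (hβ0 : 0 ≤ β) (hβ1 : β < 1) (m : ℝ)
    (π : unitInterval → Bool) (ω : unitInterval) :
    a.totalReward β m π ω = a.reward m ω (π ω) + β * a.nextMean (π ω) (a.totalReward β m π) ω := by
  have hs := a.summable_totalReward hβ0 hβ1 m π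
  have hlin : a.nextMean (π ω) (a.totalReward β m π) ω =
      ∑' t : ℕ, β ^ t * a.expectedReward m π ω (t + 1) := by
    simp only [expectedReward_succ]
    unfold nextMean totalReward
    split_ifs with h
    · rw [← tsum_mul_left, ← tsum_mul_left, ← ((hs _).mul_left _).tsum_add ((hs _).mul_left _)]
      exact tsum_congr fun t => by ring
    · rfl
  rw [hlin, ← tsum_mul_left]
  unfold totalReward
  rw [(hs ω).tsum_eq_zero_add, expectedReward_zero]
  simp only [pow_zero, one_mul, pow_succ]
  congr 1
  exact tsum_congr fun t => by ring

/-- Verification theorem: a bounded solution of the optimality equation is the value function. -/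
theorem value_eq_of_bellman (a : Arm) {β : ℝ} (hβ0 : 0 ≤ β) (hβ1 : β < 1) (m : ℝ)
    {F : unitInterval → ℝ} {C : ℝ} (hC : ∀ x, |F x| ≤ C) (hF : ∀ x, F x = a.bellman β m F x) :
    a.value β m = F := by
  have hJ := a.abs_totalReward_le hβ0 hβ1 m
  have hle : ∀ π x, a.totalReward β m π x ≤ F x := by
    intro π x
    refine sub_nonpos.1 (a.nonpos_of_le_nextMean hβ0 hβ1 π
      (F := fun x => a.totalReward β m π x - F x) (C := (1 - β)⁻¹ * (|m| + a.B) + C) (fun y => ?_)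
      (fun y => ?_) x)
    · have h1 := (abs_le.1 (hJ π y)).2
      have h2 := (abs_le.1 (hC y)).1
      linarith
    · have h : a.reward m y (π y) + β * a.nextMean (π y) F y ≤ F y := by
        rw [hF y, bellman_eq_max]
        cases π y
        · exact le_max_left _ _
        · exact le_max_right _ _
      have h1 := a.totalReward_eq hβ0 hβ1 m π y
      rw [nextMean_sub]
      linarith
  -- The greedy policy for F attains F, so the supremum over stationary policies is reached.
  let π : unitInterval → Bool := fun x => decide
    (a.reward m x false + β * a.nextMean false F x ≤ a.reward m x true + β * a.nextMean true F x)
  have hge : ∀ x, F x ≤ a.totalReward β m π x := by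
    intro x
    refine sub_nonpos.1 (a.nonpos_of_le_nextMean hβ0 hβ1 π
      (F := fun x => F x - a.totalReward β m π x) (C := (1 - β)⁻¹ * (|m| + a.B) + C) (fun y => ?_)
      (fun y => ?_) x)
    · have h1 := (abs_le.1 (hJ π y)).1
      have h2 := (abs_le.1 (hC y)).2
      linarith
    · have h : F y = a.reward m y (π y) + β * a.nextMean (π y) F y := by
        rw [hF y, bellman_eq_max]
        by_cases hy : a.reward m y false + β * a.nextMean false F y ≤
            a.reward m y true + β * a.nextMean true F y
        · simp only [π, hy, decide_true, max_eq_right]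
        · simp only [π, hy, decide_false, max_eq_left (le_of_not_ge hy)]
      have h1 := a.totalReward_eq hβ0 hβ1 m π y
      rw [nextMean_sub]
      linarith
  funext x
  refine le_antisymm (ciSup_le fun π => hle π x) ((hge x).trans ?_)
  exact le_ciSup (f := fun π => a.totalReward β m π x)
    ⟨F x, by rintro _ ⟨π, rfl⟩; exact hle π x⟩ π

/-! ### Value iteration -/

theorem continuous_update (a : Arm) : Continuous a.update := by
  unfold update
  fun_prop

/-- The Bellman operator on continuous functions. -/
def bellmanMap (a : Arm) (β m : ℝ) (F : C(unitInterval, ℝ)) : C(unitInterval, ℝ) where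
  toFun := a.bellman β m F
  continuous_toFun := by
    have := a.continuous_update
    unfold bellman
    fun_prop

theorem contractingWith_bellmanMap (a : Arm) {β : ℝ} (hβ0 : 0 ≤ β) (hβ1 : β < 1) (m : ℝ) :
    ContractingWith ⟨β, hβ0⟩ (a.bellmanMap β m) := by
  refine ⟨by exact_mod_cast hβ1, LipschitzWith.of_dist_le_mul fun F G => ?_⟩
  rw [ContinuousMap.dist_le (by positivity)]
  intro x
  have h : ∀ y, |F y - G y| ≤ dist F G := fun y => by
    rw [← Real.dist_eq]; exact ContinuousMap.dist_apply_le_dist y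
  have h0 := x.2.1
  have h1 := sub_nonneg.2 x.2.2
  change |max _ _ - max _ _| ≤ β * _
  refine (abs_max_sub_max_le_max _ _ _ _).trans (max_le ?_ ?_)
  · rw [show m + β * F (a.update x) - (m + β * G (a.update x)) =
      β * (F (a.update x) - G (a.update x)) by ring, abs_mul, abs_of_nonneg hβ0]
    exact mul_le_mul_of_nonneg_left (h _) hβ0
  · rw [show x * a.B + β * (x * F a.p11 + (1 - x) * F a.p01) -
        (x * a.B + β * (x * G a.p11 + (1 - x) * G a.p01)) =
      β * (x * (F a.p11 - G a.p11) + (1 - x) * (F a.p01 - G a.p01)) by ring, abs_mul,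
      abs_of_nonneg hβ0]
    refine mul_le_mul_of_nonneg_left ((abs_add_le _ _).trans ?_) hβ0
    rw [abs_mul, abs_mul, abs_of_nonneg h0, abs_of_nonneg h1]
    have := mul_le_mul_of_nonneg_left (h a.p11) h0
    have := mul_le_mul_of_nonneg_left (h a.p01) h1
    linarith

/-- The value function as the fixed point of the Bellman operator. -/
theorem value_eq_fixedPoint (a : Arm) {β : ℝ} (hβ0 : 0 ≤ β) (hβ1 : β < 1) (m : ℝ) :
    a.value β m = ContractingWith.fixedPoint _ (a.contractingWith_bellmanMap hβ0 hβ1 m) := by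
  set V := ContractingWith.fixedPoint _ (a.contractingWith_bellmanMap hβ0 hβ1 m) with hV
  refine a.value_eq_of_bellman hβ0 hβ1 m (C := ‖V‖) (fun x => V.norm_coe_le_norm x) fun x => ?_
  exact (DFunLike.congr_fun
    (ContractingWith.fixedPoint_isFixedPt (a.contractingWith_bellmanMap hβ0 hβ1 m)) x).symm

theorem value_eq_max (a : Arm) {β : ℝ} (hβ0 : 0 ≤ β) (hβ1 : β < 1) (m : ℝ) (x : unitInterval) :
    a.value β m x = max (a.valuePassive β m x) (a.valueActive β m x) := by
  have h := DFunLike.congr_fun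
    (ContractingWith.fixedPoint_isFixedPt (a.contractingWith_bellmanMap hβ0 hβ1 m)) x
  unfold valuePassive valueActive
  rw [value_eq_fixedPoint a hβ0 hβ1]
  exact h.symm

theorem exists_abs_value_le (a : Arm) {β : ℝ} (hβ0 : 0 ≤ β) (hβ1 : β < 1) (m : ℝ) :
    ∃ C, ∀ x, |a.value β m x| ≤ C := by
  rw [value_eq_fixedPoint a hβ0 hβ1]
  exact ⟨_, fun x => (Real.norm_eq_abs _).symm.trans_le (ContinuousMap.norm_coe_le_norm _ x)⟩

/-- The two Bellman operators differ by at most |m - m'| in sup norm, and fixed points of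
β-contractions then differ by at most 1/(1 - β) times that. This provides continuity in the subsidy.
-/
theorem abs_value_sub_le (a : Arm) {β : ℝ} (hβ0 : 0 ≤ β) (hβ1 : β < 1) (m m' : ℝ)
    (x : unitInterval) : |a.value β m x - a.value β m' x| ≤ |m - m'| / (1 - β) := by
  rw [value_eq_fixedPoint a hβ0 hβ1, value_eq_fixedPoint a hβ0 hβ1, ← Real.dist_eq]
  refine (ContinuousMap.dist_apply_le_dist x).trans
    (ContractingWith.fixedPoint_lipschitz_in_map (a.contractingWith_bellmanMap hβ0 hβ1 m)
      (a.contractingWith_bellmanMap hβ0 hβ1 m') fun F => ?_)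
  rw [ContinuousMap.dist_le (abs_nonneg _)]
  intro y
  change |max _ _ - max _ _| ≤ _
  refine (abs_max_sub_max_le_max _ _ _ _).trans (max_le (le_of_eq ?_) ?_)
  · congr 1; ring
  · simp

/-! ### Convexity in the belief and threshold structure -/

/-- Convexity of a function of the belief. -/
def ConvexBelief (F : unitInterval → ℝ) : Prop :=
  ∀ x y z : unitInterval, ∀ t : ℝ, 0 ≤ t → t ≤ 1 → (z : ℝ) = t * x + (1 - t) * y →
    F z ≤ t * F x + (1 - t) * F y

theorem ConvexBelief.comp_update {F : unitInterval → ℝ} (hF : ConvexBelief F) (a : Arm) :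
    ConvexBelief fun x => F (a.update x) := by
  intro x y z t h0 h1 hz
  refine hF _ _ _ t h0 h1 ?_
  simp only [update, hz]
  ring

theorem ConvexBelief.bellman {F : unitInterval → ℝ} (hF : ConvexBelief F) (a : Arm) {β : ℝ}
    (hβ0 : 0 ≤ β) (m : ℝ) : ConvexBelief (a.bellman β m F) := by
  intro x y z t h0 h1 hz
  have h1' := sub_nonneg.2 h1
  refine max_le ?_ ?_
  · have h := mul_le_mul_of_nonneg_left (hF.comp_update a x y z t h0 h1 hz) hβ0
    have hx := mul_le_mul_of_nonneg_left (le_max_left (m + β * F (a.update x))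
      (x * a.B + β * (x * F a.p11 + (1 - x) * F a.p01))) h0
    have hy := mul_le_mul_of_nonneg_left (le_max_left (m + β * F (a.update y))
      (y * a.B + β * (y * F a.p11 + (1 - y) * F a.p01))) h1'
    refine le_trans ?_ (add_le_add hx hy)
    linarith
  · have hx := mul_le_mul_of_nonneg_left (le_max_right (m + β * F (a.update x))
      (x * a.B + β * (x * F a.p11 + (1 - x) * F a.p01))) h0
    have hy := mul_le_mul_of_nonneg_left (le_max_right (m + β * F (a.update y))
      (y * a.B + β * (y * F a.p11 + (1 - y) * F a.p01))) h1'
    refine le_trans (le_of_eq ?_) (add_le_add hx hy)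
    rw [hz]
    ring

/-- Value iteration from 0 stays convex, since each step is a maximum of a convex and an affine
function; the pointwise limit inherits the inequality. -/
theorem convexBelief_value (a : Arm) {β : ℝ} (hβ0 : 0 ≤ β) (hβ1 : β < 1) (m : ℝ) :
    ConvexBelief (a.value β m) := by
  have hlim := (a.contractingWith_bellmanMap hβ0 hβ1 m).tendsto_iterate_fixedPoint 0
  have hpt : ∀ x, Filter.Tendsto (fun n => ((a.bellmanMap β m)^[n] 0) x) Filter.atTop
      (nhds (a.value β m x)) := fun x => by
    rw [value_eq_fixedPoint a hβ0 hβ1]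
    exact ((continuous_eval_const x).tendsto _).comp hlim
  have hn : ∀ n : ℕ, ConvexBelief ((a.bellmanMap β m)^[n] 0) := by
    intro n
    induction n with
    | zero => intro x y z t _ _ _; simp
    | succ n ih =>
      rw [Function.iterate_succ_apply']
      exact ih.bellman a hβ0 m
  intro x y z t h0 h1 hz
  exact le_of_tendsto_of_tendsto' (hpt z) (((hpt x).const_mul t).add ((hpt y).const_mul (1 - t)))
    fun n => hn n x y z t h0 h1 hz

theorem coe_update (a : Arm) (x : unitInterval) :
    (a.update x : ℝ) = x * a.p11 + (1 - x) * a.p01 := rfl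

theorem update_zero (a : Arm) : a.update 0 = a.p01 := by
  ext; simp [coe_update]

theorem update_one (a : Arm) : a.update 1 = a.p11 := by
  ext; simp [coe_update]

/-- Advantage of the passive action. -/
def advantage (a : Arm) (β m : ℝ) (ω : unitInterval) : ℝ :=
  a.valuePassive β m ω - a.valueActive β m ω

theorem advantage_zero (a : Arm) (β m : ℝ) : a.advantage β m 0 = m := by
  simp [advantage, valuePassive, valueActive, update_zero]

theorem advantage_one (a : Arm) (β m : ℝ) : a.advantage β m 1 = m - a.B := by
  simp [advantage, valuePassive, valueActive, update_one]


theorem convexBelief_advantage (a : Arm) {β : ℝ} (hβ0 : 0 ≤ β) (hβ1 : β < 1) (m : ℝ) :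
    ConvexBelief (a.advantage β m) := by
  intro x y z t h0 h1 hz
  have h := mul_le_mul_of_nonneg_left
    ((a.convexBelief_value hβ0 hβ1 m).comp_update a x y z t h0 h1 hz) hβ0
  have hz' : a.valueActive β m z =
      t * a.valueActive β m x + (1 - t) * a.valueActive β m y := by
    simp only [valueActive, hz]
    ring
  simp only [advantage, hz']
  unfold valuePassive
  linarith

theorem advantage_neg (a : Arm) {β : ℝ} (hβ0 : 0 ≤ β) (hβ1 : β < 1) {m : ℝ} (hm : m < 0)
    (ω : unitInterval) : a.advantage β m ω < 0 := by
  have h0 := ω.2.1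
  have h1 := ω.2.2
  have h := a.convexBelief_advantage hβ0 hβ1 m 1 0 ω ω h0 h1 (by simp)
  rw [advantage_zero, advantage_one] at h
  have := mul_nonneg h0 a.B_pos.le
  linarith

theorem value_of_rate_le (a : Arm) {β : ℝ} (hβ0 : 0 ≤ β) (hβ1 : β < 1) {m : ℝ} (hm : a.B ≤ m)
    (x : unitInterval) : a.value β m x = m / (1 - β) := by
  have h1 : 1 - β ≠ 0 := by linarith
  rw [a.value_eq_of_bellman hβ0 hβ1 m (F := fun _ => m / (1 - β)) (C := |m / (1 - β)|)
    (fun _ => le_rfl)]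
  intro y
  have hy : y * a.B ≤ m := by
    have h0 := y.2.1
    have h1 := y.2.2
    have := a.B_pos
    nlinarith
  unfold bellman
  rw [max_eq_left (by linarith)]
  field_simp
  ring

theorem advantage_of_rate_le (a : Arm) {β : ℝ} (hβ0 : 0 ≤ β) (hβ1 : β < 1) {m : ℝ}
    (hm : a.B ≤ m) (ω : unitInterval) : a.advantage β m ω = m - ω * a.B := by
  simp only [advantage, valuePassive, valueActive, a.value_of_rate_le hβ0 hβ1 hm]
  ring

theorem continuous_advantage (a : Arm) {β : ℝ} (hβ0 : 0 ≤ β) (hβ1 : β < 1) (ω : unitInterval) :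
    Continuous fun m => a.advantage β m ω := by
  have hv : ∀ x, Continuous fun m => a.value β m x := fun x => by
    refine (LipschitzWith.of_dist_le_mul
      (K := ⟨(1 - β)⁻¹, inv_nonneg.2 (by linarith)⟩) fun m m' => ?_).continuous
    rw [Real.dist_eq, Real.dist_eq]
    refine (a.abs_value_sub_le hβ0 hβ1 m m' x).trans (le_of_eq ?_)
    rw [div_eq_inv_mul]
    rfl
  have h1 := hv (a.update ω)
  have h2 := hv a.p11
  have h3 := hv a.p01
  unfold advantage valuePassive valueActive
  fun_prop

theorem subsidy_mem_of_advantage_eq_zero (a : Arm) {β : ℝ} (hβ0 : 0 ≤ β) (hβ1 : β < 1) {m : ℝ}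
    {ω : unitInterval} (h : a.advantage β m ω = 0) (hω : (ω : ℝ) < 1) : 0 ≤ m ∧ m < a.B := by
  refine ⟨not_lt.1 fun hm => (a.advantage_neg hβ0 hβ1 hm ω).ne h, not_le.1 fun hm => ?_⟩
  rw [a.advantage_of_rate_le hβ0 hβ1 hm] at h
  have := a.B_pos
  nlinarith

/-- With subsidy `m`, the beliefs below `ω` are passive, those above are active. -/
structure IsThreshold (a : Arm) (β m : ℝ) (ω : unitInterval) : Prop where
  nonneg : 0 ≤ m
  lt_rate : m < a.B
  advantage_eq : a.advantage β m ω = 0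
  passive : ∀ x ≤ ω, a.value β m x = a.valuePassive β m x
  active : ∀ x, ω ≤ x → a.value β m x = a.valueActive β m x
  strict : ∀ x < ω, 0 < a.advantage β m x

/-- A convex function that vanishes at ω and is negative at 1 is positive left of ω and nonpositive
right of it. The condition ω < 1 rules out m = B, for which the advantage at 1 is zero. -/
theorem isThreshold_of_advantage_eq_zero (a : Arm) {β : ℝ} (hβ0 : 0 ≤ β) (hβ1 : β < 1) {m : ℝ}
    {ω : unitInterval} (h : a.advantage β m ω = 0) (hω : (ω : ℝ) < 1) :
    a.IsThreshold β m ω := by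
  obtain ⟨hm0, hm1⟩ := a.subsidy_mem_of_advantage_eq_zero hβ0 hβ1 h hω
  have hconv := a.convexBelief_advantage hβ0 hβ1 m
  have hstrict : ∀ x < ω, 0 < a.advantage β m x := by
    intro x hx
    have hx' : (x : ℝ) < ω := hx
    have hd : 0 < 1 - (x : ℝ) := by linarith
    have ht : 0 < (1 - (ω : ℝ)) / (1 - x) := div_pos (by linarith) hd
    have ht1 : (1 - (ω : ℝ)) / (1 - x) < 1 := (div_lt_one hd).2 (by linarith)
    have := hconv x 1 ω ((1 - (ω : ℝ)) / (1 - x)) ht.le ht1.le (by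
      simp only [Set.Icc.coe_one]; field_simp; ring)
    rw [h, advantage_one] at this
    by_contra hneg
    nlinarith
  refine ⟨hm0, hm1, h, fun x hx => ?_, fun x hx => ?_, hstrict⟩
  · rw [a.value_eq_max hβ0 hβ1]
    refine max_eq_left (sub_nonneg.1 ?_)
    rcases hx.lt_or_eq with hx | rfl
    · exact (hstrict x hx).le
    · exact h.ge
  · rw [a.value_eq_max hβ0 hβ1]
    refine max_eq_right (sub_nonpos.1 ?_)
    have hx' : (ω : ℝ) ≤ x := hx
    have hd : 0 < 1 - (ω : ℝ) := by linarith
    have ht : (1 - (x : ℝ)) / (1 - ω) ≤ 1 := (div_le_one hd).2 (by linarith)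
    have := hconv ω 1 x ((1 - (x : ℝ)) / (1 - ω)) (div_nonneg (by linarith [x.2.2]) hd.le) ht (by
      simp only [Set.Icc.coe_one]; field_simp; ring)
    rw [h, advantage_one] at this
    refine this.trans ?_
    nlinarith

/-! ### Bounds and passive orbits -/

theorem le_value (a : Arm) {β : ℝ} (hβ0 : 0 ≤ β) (hβ1 : β < 1) (m : ℝ) (x : unitInterval) :
    m / (1 - β) ≤ a.value β m x := by
  obtain ⟨C, hC⟩ := a.exists_abs_value_le hβ0 hβ1 m
  refine sub_nonpos.1 (a.nonpos_of_le_nextMean hβ0 hβ1 (fun _ => false)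
    (F := fun x => m / (1 - β) - a.value β m x) (C := m / (1 - β) + C)
    (fun y => by linarith [(abs_le.1 (hC y)).1]) (fun y => ?_) x)
  have h := (le_max_left _ _).trans_eq (a.value_eq_max hβ0 hβ1 m y).symm
  have h1 : m / (1 - β) = m + β * (m / (1 - β)) := by
    have : 1 - β ≠ 0 := by linarith
    field_simp
    ring
  simp only [valuePassive] at h
  simp only [nextMean, Bool.false_eq_true, if_false]
  linarith

theorem value_le (a : Arm) {β : ℝ} (hβ0 : 0 ≤ β) (hβ1 : β < 1) {m : ℝ} (hm : m ≤ a.B)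
    (x : unitInterval) : a.value β m x ≤ a.B / (1 - β) := by
  obtain ⟨C, hC⟩ := a.exists_abs_value_le hβ0 hβ1 m
  refine sub_nonpos.1 (a.nonpos_of_le_nextMean hβ0 hβ1
    (fun x => decide (a.valuePassive β m x ≤ a.valueActive β m x))
    (F := fun x => a.value β m x - a.B / (1 - β)) (C := C - a.B / (1 - β))
    (fun y => by linarith [(abs_le.1 (hC y)).2]) (fun y => ?_) x)
  have h := a.value_eq_max hβ0 hβ1 m y
  have h1 : a.B / (1 - β) = a.B + β * (a.B / (1 - β)) := by
    have : 1 - β ≠ 0 := by linarith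
    field_simp
    ring
  by_cases hy : a.valuePassive β m y ≤ a.valueActive β m y
  · have hyB : y * a.B ≤ a.B := by nlinarith [y.2.2, a.B_pos]
    rw [max_eq_right hy] at h
    simp only [nextMean, hy, decide_true, if_true]
    simp only [valueActive] at h
    linarith
  · rw [max_eq_left (le_of_not_ge hy)] at h
    simp only [nextMean, hy, decide_false, Bool.false_eq_true, if_false]
    simp only [valuePassive] at h
    linarith

theorem value_of_passive_invariant (a : Arm) {β : ℝ} (hβ0 : 0 ≤ β) (hβ1 : β < 1) {m : ℝ}
    {S : Set unitInterval} (hS : ∀ x ∈ S, a.update x ∈ S)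
    (hp : ∀ x ∈ S, a.value β m x = a.valuePassive β m x) {x : unitInterval} (hx : x ∈ S) :
    a.value β m x = m / (1 - β) := by
  obtain ⟨C, hC⟩ := a.exists_abs_value_le hβ0 hβ1 m
  refine le_antisymm (sub_nonpos.1 ?_) (a.le_value hβ0 hβ1 m x)
  classical
  -- The excess over m / (1 - β) is extended by 0 off S. A belief outside S may move into S, where
  -- the excess is nonnegative by `le_value`, so the inequality survives there.
  have := a.nonpos_of_le_nextMean hβ0 hβ1 (fun _ => false)
    (F := fun x => if x ∈ S then a.value β m x - m / (1 - β) else 0) (C := C + |m / (1 - β)|)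
    (fun y => ?_) (fun y => ?_) x
  · simpa only [hx, if_true] using this
  · have h1 := abs_le.1 (hC y)
    have h2 := neg_abs_le (m / (1 - β))
    have h3 := abs_nonneg (m / (1 - β))
    split_ifs <;> linarith
  · have h1 : m / (1 - β) = m + β * (m / (1 - β)) := by
      have : 1 - β ≠ 0 := by linarith
      field_simp
      ring
    simp only [nextMean, Bool.false_eq_true, if_false]
    by_cases hy : y ∈ S
    · have h := hp y hy
      simp only [valuePassive] at h
      simp only [hy, hS y hy, if_true]
      linarith
    · simp only [hy, if_false]
      split_ifs with hu
      · exact mul_nonneg hβ0 (sub_nonneg.2 (a.le_value hβ0 hβ1 m _))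
      · simp

theorem value_of_passive_iterate (a : Arm) {β m : ℝ} {x : unitInterval} (L : ℕ)
    (h : ∀ j < L, a.value β m (a.update^[j] x) = a.valuePassive β m (a.update^[j] x)) :
    (1 - β) * a.value β m x =
      m * (1 - β ^ L) + (1 - β) * β ^ L * a.value β m (a.update^[L] x) := by
  induction L with
  | zero => simp
  | succ L ih =>
    have hL := h L L.lt_succ_self
    rw [ih fun j hj => h j (hj.trans L.lt_succ_self), hL, valuePassive,
      Function.iterate_succ_apply', pow_succ]
    ring

/-! ### The subsidy that makes both actions optimal -/

namespace IsThreshold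

variable {a : Arm} {β m : ℝ} {ω : unitInterval}

theorem passive_eq_active (h : a.IsThreshold β m ω) :
    m + β * a.value β m (a.update ω) =
      ω * a.B + β * (ω * a.value β m a.p11 + (1 - ω) * a.value β m a.p01) :=
  sub_eq_zero.1 h.advantage_eq

theorem active_eq (h : a.IsThreshold β m ω) {x : unitInterval} (hx : (ω : ℝ) ≤ x) :
    a.value β m x =
      x * a.B + β * (x * a.value β m a.p11 + (1 - x) * a.value β m a.p01) :=
  h.active x hx

theorem passive_eq (h : a.IsThreshold β m ω) {x : unitInterval} (hx : (x : ℝ) ≤ ω) :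
    a.value β m x = m + β * a.value β m (a.update x) :=
  h.passive x hx

/-- All possible next beliefs are active, and there the value is affine; hence observing the channel
brings no gain and the continuation terms cancel. -/
theorem subsidy_of_le (h : a.IsThreshold β m ω) (h1 : (ω : ℝ) ≤ a.p11) (h0 : (ω : ℝ) ≤ a.p01) :
    m = ω * a.B := by
  have hT : (ω : ℝ) ≤ a.update ω := by
    rw [coe_update]
    nlinarith [ω.2.1, ω.2.2]
  have e := h.passive_eq_active
  have e1 := h.active_eq h1
  have e0 := h.active_eq h0
  have eT := h.active_eq hT
  rw [coe_update] at eT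
  linear_combination e - β * eT + β * ω * e1 + β * (1 - ω) * e0

/-- All possible next beliefs stay passive forever, so every continuation value is m / (1 - β) and
cancels. -/
theorem subsidy_of_ge (hβ0 : 0 ≤ β) (hβ1 : β < 1) (h : a.IsThreshold β m ω)
    (h1 : (a.p11 : ℝ) ≤ ω) (h0 : (a.p01 : ℝ) ≤ ω) : m = ω * a.B := by
  have hT : ∀ x, a.update x ≤ ω := fun x => by
    change (a.update x : ℝ) ≤ ω
    rw [coe_update]
    nlinarith [x.2.1, x.2.2]
  have hv : ∀ x ≤ ω, a.value β m x = m / (1 - β) := fun x hx =>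
    a.value_of_passive_invariant hβ0 hβ1 (S := Set.Iic ω) (fun x _ => hT x) h.passive hx
  have e := h.passive_eq_active
  rw [hv _ (hT ω), hv a.p11 h1, hv a.p01 h0] at e
  linear_combination e

theorem subsidy_of_update_le (hβ0 : 0 ≤ β) (hβ1 : β < 1) (h : a.IsThreshold β m ω)
    (hp : (a.p01 : ℝ) ≤ a.p11) (hT : (a.update ω : ℝ) ≤ ω) (h1 : (ω : ℝ) ≤ a.p11) :
    0 < 1 - β * a.p11 + β * ω ∧ m * (1 - β * a.p11 + β * ω) = ω * a.B := by
  refine ⟨by nlinarith [ω.2.1, a.p11.2.2, a.p11.2.1], ?_⟩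
  -- The update is increasing and does not raise ω, so beliefs up to ω stay passive forever; p01 is
  -- among them, and only the value at p11 remains to be eliminated.
  have hS : ∀ x ∈ Set.Iic ω, a.update x ∈ Set.Iic ω := fun x hx => by
    have hx' : (x : ℝ) ≤ ω := hx
    change (a.update x : ℝ) ≤ ω
    rw [coe_update] at hT ⊢
    nlinarith
  have h0 : (a.p01 : ℝ) ≤ ω := by
    rw [coe_update] at hT
    nlinarith [ω.2.1]
  have hv : ∀ x ≤ ω, a.value β m x = m / (1 - β) := fun x hx =>
    a.value_of_passive_invariant hβ0 hβ1 hS h.passive hx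
  have e := h.passive_eq_active
  have e1 := h.active_eq h1
  have eM : m = (1 - β) * (m / (1 - β)) := by
    have : 1 - β ≠ 0 := by linarith
    field_simp
  rw [hv _ hT, hv a.p01 h0] at e
  rw [hv a.p01 h0] at e1
  generalize m / (1 - β) = M at *
  generalize a.value β m a.p11 = X at *
  subst eM
  linear_combination (1 - β * a.p11) * e + β * ω * e1

/-- The passive orbit of p01 increases and reaches the active region after k + 1 steps, so V(p01) is
a discounted sum of k + 1 subsidies plus an active value. Here A = β + ... + β^(k+1), and q = ω -
βT(ω). -/
theorem subsidy_of_lt_update (hβ0 : 0 ≤ β) (hβ1 : β < 1) (h : a.IsThreshold β m ω)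
    (hp : (a.p01 : ℝ) ≤ a.p11) (hT : (ω : ℝ) ≤ a.update ω) {k : ℕ}
    (hk : a.update^[k] a.p01 ≤ ω) (hk' : ω ≤ a.update^[k + 1] a.p01) :
    let A := β * (1 - β ^ (k + 1)) / (1 - β)
    let q := ω * (1 - β * (a.p11 - a.p01)) - β * a.p01
    let c := β ^ (k + 2) * (a.update^[k + 1] a.p01 : ℝ)
    0 < 1 - β * a.p11 + A * q + c ∧ m * (1 - β * a.p11 + A * q + c) = (q + A * q + c) * a.B := by
  intro A q c
  have hmono : Monotone a.update := fun x y hxy => by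
    have hxy' : (x : ℝ) ≤ y := hxy
    change (a.update x : ℝ) ≤ a.update y
    rw [coe_update, coe_update]
    nlinarith
  have h0 : a.p01 ≤ a.update a.p01 := by
    rw [← update_zero]
    exact hmono bot_le
  have hiter := hmono.monotone_iterate_of_le_map h0
  have h1 : (ω : ℝ) ≤ a.p11 := by
    refine hT.trans ?_
    rw [coe_update]
    nlinarith [ω.2.2]
  have e := h.passive_eq_active
  have e1 := h.active_eq h1
  have eT := h.active_eq hT
  have ex := h.active_eq hk'
  have eb := a.value_of_passive_iterate (k + 1) fun j hj =>
    h.passive _ ((hiter (Nat.lt_succ_iff.1 hj)).trans hk)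
  have hb := a.value_le hβ0 hβ1 h.lt_rate.le a.p01
  rw [coe_update] at eT
  have hA : A * (1 - β) = β * (1 - β ^ (k + 1)) := by
    have : 1 - β ≠ 0 := by linarith
    simp only [A]
    field_simp
  rw [le_div_iff₀ (by linarith)] at hb
  rw [ex] at eb
  rw [eT] at e
  have hB := a.B_pos
  have hp1 := a.p11.2.2
  have hp0 := a.p11.2.1
  have hr : 0 < 1 - β * (a.p11 : ℝ) := by nlinarith
  have hc : c = β ^ (k + 1) * β * (a.update^[k + 1] a.p01 : ℝ) := by simp only [c]; ring
  have hq : q = ω * (1 - β * (a.p11 - a.p01)) - β * a.p01 := rfl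
  clear_value A q c
  generalize (a.update^[k + 1] a.p01 : ℝ) = x at *
  generalize β ^ (k + 1) = y at *
  generalize a.value β m a.p11 = X at *
  generalize a.value β m a.p01 = Y at *
  -- s is the slope of the active value in the belief. Both m and B turn out to be multiples of s,
  -- so s drops out of their ratio.
  obtain ⟨s, hs⟩ : ∃ s, s = a.B + β * (X - Y) := ⟨_, rfl⟩
  have hsr : s * (1 - β * a.p11) = a.B - β * (1 - β) * Y := by
    linear_combination (1 - β * a.p11) * hs + β * e1
  -- From V(p01) ≤ B / (1 - β) and β < 1.
  have hs0 : 0 < s := by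
    refine pos_of_mul_pos_left (b := 1 - β * (a.p11 : ℝ)) ?_ hr.le
    rw [hsr]
    nlinarith
  have hm : m = q * s + β * (1 - β) * Y := by
    subst hs hq
    linear_combination e
  have hY : β * (1 - β) * Y = s * (A * q + c) := by
    have h1β : (1 - β) ≠ 0 := by linarith
    refine mul_left_cancel₀ h1β ?_
    subst hs hc
    linear_combination β * eb + β * (1 - y) * hm - q * (a.B + β * (X - Y)) * hA
  have hBs : a.B = s * (1 - β * a.p11 + A * q + c) := by linear_combination -hsr + hY
  refine ⟨pos_of_mul_pos_right (hBs ▸ hB) hs0.le, ?_⟩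
  linear_combination (1 - β * a.p11 + A * q + c) * (hm + hY) - (q + A * q + c) * hBs

/-- Since p01 is active, p01 times the slope equals (1 - β) * V(p01), which is nonnegative because m
is. -/
theorem slope_nonneg (hβ0 : 0 ≤ β) (hβ1 : β < 1) (h : a.IsThreshold β m ω)
    (hp : (a.p11 : ℝ) < a.p01) (h0 : (ω : ℝ) ≤ a.p01) :
    0 ≤ a.B + β * (a.value β m a.p11 - a.value β m a.p01) := by
  have e0 := h.active_eq h0
  have hY : 0 ≤ a.value β m a.p01 :=
    (div_nonneg h.nonneg (by linarith)).trans (a.le_value hβ0 hβ1 m _)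
  refine nonneg_of_mul_nonneg_right (a := (a.p01 : ℝ)) ?_ (a.p11.2.1.trans_lt hp)
  nlinarith

theorem subsidy_of_slope {n d s : ℝ} (hs : 0 ≤ s) (hm : m = n * s) (hB : a.B = s * d) :
    0 < d ∧ m * d = n * a.B := by
  have hBp := a.B_pos
  have hs0 : 0 < s := hs.lt_of_ne fun h => by rw [hB, ← h, zero_mul] at hBp; exact hBp.false
  exact ⟨pos_of_mul_pos_right (hB ▸ hBp) hs0.le, by rw [hm, hB]; ring⟩

theorem subsidy_of_lt_update' (hβ0 : 0 ≤ β) (hβ1 : β < 1) (h : a.IsThreshold β m ω)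
    (hp : (a.p11 : ℝ) < a.p01) (hT : (ω : ℝ) ≤ a.update ω) (h1 : (a.p11 : ℝ) ≤ ω) :
    let n := (1 - β * (a.p11 - a.p01)) * (ω : ℝ)
    let d := 1 + β * (1 + β) * a.p01 - β ^ 2 * a.update a.p11 - β * n
    0 < d ∧ m * d = n * a.B := by
  intro n d
  -- The update is now decreasing, so the passive belief p11 jumps to the active side in one step.
  have hy : (ω : ℝ) ≤ a.update a.p11 := by
    rw [coe_update] at hT ⊢
    nlinarith
  have h0 : (ω : ℝ) ≤ a.p01 := by
    rw [coe_update] at hT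
    nlinarith [ω.2.1]
  have hs := h.slope_nonneg hβ0 hβ1 hp h0
  have e := h.passive_eq_active
  have e1 := h.passive_eq h1
  have e0 := h.active_eq h0
  rw [h.active_eq hT] at e
  rw [h.active_eq hy] at e1
  rw [coe_update] at e
  have hm : m = n * (a.B + β * (a.value β m a.p11 - a.value β m a.p01)) := by
    simp only [n]
    linear_combination e + β * e0
  refine subsidy_of_slope hs hm ?_
  simp only [d]
  linear_combination (-β) * e1 + β * (1 + β) * e0 - β * hm

/-- For a decreasing update, the beliefs up to ω need not be invariant, so two consecutive beliefs
are tracked. The twofold update T² has slope (p11 - p01)² ≥ 0, and ω - T²(ω) = (1 + p11 - p01)(ω -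
T(ω)) ≥ 0. -/
theorem update_orbit (hT : (a.update ω : ℝ) ≤ ω) :
    ∀ x ∈ {x : unitInterval | x ≤ ω ∧ a.update x ≤ ω},
      a.update x ∈ {x : unitInterval | x ≤ ω ∧ a.update x ≤ ω} := by
  rintro x ⟨hx, hx'⟩
  refine ⟨hx', ?_⟩
  have hx : (x : ℝ) ≤ ω := hx
  change (a.update (a.update x) : ℝ) ≤ ω
  rw [coe_update] at hT
  rw [coe_update, coe_update]
  have h1 := a.p11.2.1
  have h2 := a.p01.2.2
  have e1 : 0 ≤ (ω - x) * ((a.p01 : ℝ) - a.p11) ^ 2 := mul_nonneg (by linarith) (sq_nonneg _)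
  have e2 : 0 ≤ (1 + (a.p11 - a.p01 : ℝ)) * (ω - (ω * a.p11 + (1 - ω) * a.p01)) :=
    mul_nonneg (by linarith) (by linarith)
  nlinarith

theorem subsidy_of_update_le_of_le_update (hβ0 : 0 ≤ β) (hβ1 : β < 1) (h : a.IsThreshold β m ω)
    (hp : (a.p11 : ℝ) < a.p01) (hT : (a.update ω : ℝ) ≤ ω) (hy : (ω : ℝ) ≤ a.update a.p11) :
    let n := (1 - β) * ω + β * a.p01
    let d := 1 + β * (1 + β) * a.p01 - β ^ 2 * a.update a.p11 - β * n
    0 < d ∧ m * d = n * a.B := by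
  intro n d
  have h0 : (ω : ℝ) ≤ a.p01 := by
    rw [coe_update] at hy
    nlinarith [a.p11.2.1]
  have h1 : (a.p11 : ℝ) ≤ ω := by
    rw [coe_update] at hT
    nlinarith [ω.2.2]
  have hs := h.slope_nonneg hβ0 hβ1 hp h0
  have hTS := update_orbit hT (a.update ω)
  have hTω : a.update (a.update ω) ≤ ω := (update_orbit hT ω ⟨le_rfl, hT⟩).2
  have hv := a.value_of_passive_invariant hβ0 hβ1 (m := m) (update_orbit hT)
    (fun x hx => h.passive x hx.1) (x := a.update ω) ⟨hT, hTω⟩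
  have e := h.passive_eq_active
  have e1 := h.passive_eq h1
  have e0 := h.active_eq h0
  rw [h.active_eq hy] at e1
  have eM : m = (1 - β) * (m / (1 - β)) := by
    have : 1 - β ≠ 0 := by linarith
    field_simp
  rw [hv] at e
  have hm : m = n * (a.B + β * (a.value β m a.p11 - a.value β m a.p01)) := by
    simp only [n]
    linear_combination (1 - β) * e + β * e0 + β * eM
  refine subsidy_of_slope hs hm ?_
  simp only [d]
  linear_combination (-β) * e1 + β * (1 + β) * e0 - β * hm

theorem subsidy_of_update_le' (hβ0 : 0 ≤ β) (hβ1 : β < 1) (h : a.IsThreshold β m ω)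
    (hp : (a.p11 : ℝ) < a.p01) (h1 : (a.p11 : ℝ) ≤ ω) (hy : (a.update a.p11 : ℝ) ≤ ω)
    (h0 : (ω : ℝ) ≤ a.p01) :
    let n := (1 - β) * ω + β * a.p01
    let d := 1 + β * a.p01 - β * ω
    0 < d ∧ m * d = n * a.B := by
  intro n d
  have hT : (a.update ω : ℝ) ≤ ω := by
    refine le_trans ?_ hy
    rw [coe_update, coe_update]
    nlinarith
  have hs := h.slope_nonneg hβ0 hβ1 hp h0
  have hTω : a.update (a.update ω) ≤ ω := (update_orbit hT ω ⟨le_rfl, hT⟩).2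
  have hv : ∀ x, x ≤ ω → a.update x ≤ ω → a.value β m x = m / (1 - β) := fun x hx hx' =>
    a.value_of_passive_invariant hβ0 hβ1 (update_orbit hT)
      (fun x hx => h.passive x hx.1) ⟨hx, hx'⟩
  have e := h.passive_eq_active
  have e1 := hv a.p11 h1 hy
  have e0 := h.active_eq h0
  have eM : m = (1 - β) * (m / (1 - β)) := by
    have : 1 - β ≠ 0 := by linarith
    field_simp
  rw [hv _ hT hTω] at e
  have hm : m = n * (a.B + β * (a.value β m a.p11 - a.value β m a.p01)) := by
    simp only [n]
    linear_combination (1 - β) * e + β * e0 + β * eM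
  refine subsidy_of_slope hs hm ?_
  have h1β : (1 - β) ≠ 0 := by linarith
  refine mul_left_cancel₀ h1β ?_
  simp only [d]
  linear_combination (-β) * (1 - β) * e1 + β * e0 - β * hm + β * eM
end IsThreshold

/-! ### Uniqueness of the critical subsidy, indexability and monotonicity -/

theorem exists_iterate_update_le_lt (a : Arm) {ω : unitInterval}
    (hω : (a.p01 : ℝ) ≤ ω) (hT : (ω : ℝ) < a.update ω) :
    ∃ k : ℕ, a.update^[k] a.p01 ≤ ω ∧ ω < a.update^[k + 1] a.p01 := by
  by_contra! hcon
  have hle : ∀ k : ℕ, a.update^[k] a.p01 ≤ ω := by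
    intro k
    induction k with
    | zero => exact hω
    | succ k ih => exact hcon k ih
  -- The increment T(x) - x is nonincreasing in x, so below ω each step gains at least T(ω) - ω; an
  -- orbit stuck below ω would leave [0, 1].
  have hgrow : ∀ k : ℕ, k * ((a.update ω : ℝ) - ω) ≤ a.update^[k] a.p01 := by
    intro k
    induction k with
    | zero => simpa using a.p01.2.1
    | succ k ih =>
      have hk : (a.update^[k] a.p01 : ℝ) ≤ ω := hle k
      have h1 := a.p11.2.2
      have h0 := a.p01.2.1
      have : 0 ≤ (ω - (a.update^[k] a.p01 : ℝ)) * (1 - (a.p11 - a.p01)) :=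
        mul_nonneg (by linarith) (by linarith)
      rw [Function.iterate_succ_apply', coe_update a (a.update^[k] a.p01), Nat.cast_succ]
      rw [coe_update] at ih hT ⊢
      nlinarith
  obtain ⟨k, hk⟩ := exists_nat_gt (1 / ((a.update ω : ℝ) - ω))
  rw [div_lt_iff₀ (sub_pos.2 hT)] at hk
  linarith [hgrow k, (a.update^[k] a.p01).2.2]

theorem eq_of_mul_eq {m m' d e : ℝ} (h : 0 < d ∧ m * d = e) (h' : 0 < d ∧ m' * d = e) : m = m' :=
  mul_right_cancel₀ h.1.ne' (h.2.trans h'.2.symm)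

/-- The case split, including the crossing time k, depends on ω and the arm but not on the subsidy,
so both roots satisfy the same linear equation with nonzero coefficient. -/
theorem advantage_root_unique (a : Arm) {β : ℝ} (hβ0 : 0 ≤ β) (hβ1 : β < 1) {m m' : ℝ}
    {ω : unitInterval} (h : a.advantage β m ω = 0) (h' : a.advantage β m' ω = 0) : m = m' := by
  rcases eq_or_lt_of_le (unitInterval.le_one' : ω ≤ 1) with rfl | hω
  · rw [advantage_one] at h h'
    linarith
  have ht := a.isThreshold_of_advantage_eq_zero hβ0 hβ1 h hω
  have ht' := a.isThreshold_of_advantage_eq_zero hβ0 hβ1 h' hω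
  rcases le_or_gt (a.p01 : ℝ) a.p11 with hp | hp
  · rcases le_or_gt (ω : ℝ) a.p01 with h0 | h0
    · rw [ht.subsidy_of_le (h0.trans hp) h0, ht'.subsidy_of_le (h0.trans hp) h0]
    rcases le_or_gt (a.p11 : ℝ) ω with h1 | h1
    · rw [ht.subsidy_of_ge hβ0 hβ1 h1 h0.le, ht'.subsidy_of_ge hβ0 hβ1 h1 h0.le]
    rcases le_or_gt (a.update ω : ℝ) ω with hT | hT
    · exact eq_of_mul_eq (ht.subsidy_of_update_le hβ0 hβ1 hp hT h1.le)
        (ht'.subsidy_of_update_le hβ0 hβ1 hp hT h1.le)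
    · obtain ⟨k, hk, hk'⟩ := a.exists_iterate_update_le_lt h0.le hT
      exact eq_of_mul_eq (ht.subsidy_of_lt_update hβ0 hβ1 hp hT.le hk hk'.le)
        (ht'.subsidy_of_lt_update hβ0 hβ1 hp hT.le hk hk'.le)
  · rcases le_or_gt (ω : ℝ) a.p11 with h1 | h1
    · rw [ht.subsidy_of_le h1 (h1.trans hp.le), ht'.subsidy_of_le h1 (h1.trans hp.le)]
    rcases le_or_gt (a.p01 : ℝ) ω with h0 | h0
    · rw [ht.subsidy_of_ge hβ0 hβ1 h1.le h0, ht'.subsidy_of_ge hβ0 hβ1 h1.le h0]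
    rcases le_or_gt (ω : ℝ) (a.update ω) with hT | hT
    · exact eq_of_mul_eq (ht.subsidy_of_lt_update' hβ0 hβ1 hp hT h1.le)
        (ht'.subsidy_of_lt_update' hβ0 hβ1 hp hT h1.le)
    rcases le_or_gt (ω : ℝ) (a.update a.p11) with hy | hy
    · exact eq_of_mul_eq (ht.subsidy_of_update_le_of_le_update hβ0 hβ1 hp hT.le hy)
        (ht'.subsidy_of_update_le_of_le_update hβ0 hβ1 hp hT.le hy)
    · exact eq_of_mul_eq (ht.subsidy_of_update_le' hβ0 hβ1 hp h1.le hy.le h0.le)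
        (ht'.subsidy_of_update_le' hβ0 hβ1 hp h1.le hy.le h0.le)

theorem exists_advantage_root (a : Arm) {β : ℝ} (hβ0 : 0 ≤ β) (hβ1 : β < 1) (ω : unitInterval) :
    ∃ w, a.advantage β w ω = 0 ∧ ∀ m, 0 ≤ a.advantage β m ω ↔ w ≤ m := by
  have hc := a.continuous_advantage hβ0 hβ1 ω
  have hlow : ∀ m < 0, a.advantage β m ω < 0 := fun m hm => a.advantage_neg hβ0 hβ1 hm ω
  have hhigh : ∀ m, a.B ≤ m → 0 ≤ a.advantage β m ω := fun m hm => by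
    rw [a.advantage_of_rate_le hβ0 hβ1 hm]
    nlinarith [ω.2.2, a.B_pos]
  have hivt : ∀ m m', m ≤ m' → a.advantage β m ω ≤ 0 → 0 ≤ a.advantage β m' ω →
      ∃ z ∈ Set.Icc m m', a.advantage β z ω = 0 := fun m m' hmm h h' =>
    intermediate_value_Icc hmm hc.continuousOn ⟨h, h'⟩
  obtain ⟨w, -, hw⟩ := hivt (-1) a.B (by linarith [a.B_pos]) (hlow _ (by norm_num)).le
    (hhigh _ le_rfl)
  refine ⟨w, hw, fun m => ⟨fun h => ?_, fun h => ?_⟩⟩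
  -- A sign of D on the wrong side of w would produce another root; uniqueness identifies it with w.
  · obtain ⟨z, hz, hz0⟩ := hivt (min m 0 - 1) m (by linarith [min_le_left m 0])
      (hlow _ (by linarith [min_le_right m 0])).le h
    rw [a.advantage_root_unique hβ0 hβ1 hw hz0]
    exact hz.2
  · by_contra! hneg
    obtain ⟨z, hz, hz0⟩ := hivt m (max m a.B) (le_max_left _ _) hneg.le
      (hhigh _ (le_max_right _ _))
    have hzw := a.advantage_root_unique hβ0 hβ1 hw hz0
    have : m = w := le_antisymm (hzw ▸ hz.1) h
    rw [this, hw] at hneg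
    exact hneg.false

theorem whittleIndex_spec (a : Arm) {β : ℝ} (hβ0 : 0 ≤ β) (hβ1 : β < 1) (ω : unitInterval) :
    a.advantage β (a.whittleIndex β ω) ω = 0 ∧
      ∀ m, ω ∈ a.passiveSet β m ↔ a.whittleIndex β ω ≤ m := by
  obtain ⟨w, hw, hiff⟩ := a.exists_advantage_root hβ0 hβ1 ω
  have hmem : ∀ m, ω ∈ a.passiveSet β m ↔ w ≤ m := fun m => by
    rw [← hiff m, advantage, sub_nonneg]
    rfl
  have : a.whittleIndex β ω = w := by
    have hset : {m : ℝ | ω ∈ a.passiveSet β m} = Set.Ici w := Set.ext hmem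
    rw [whittleIndex, hset, csInf_Ici]
  rw [this]
  exact ⟨hw, hmem⟩

theorem indexable (a : Arm) {β : ℝ} (hβ0 : 0 ≤ β) (hβ1 : β < 1) : a.Indexable β := by
  have h := fun ω => (a.whittleIndex_spec hβ0 hβ1 ω).2
  refine ⟨fun m m' hm ω hω => (h ω m').2 (((h ω m).1 hω).trans hm), ?_, ?_⟩
  · refine Set.eq_empty_iff_forall_notMem.2 fun ω hω => ?_
    have := (h ω _).1 (Set.mem_iInter.1 hω (a.whittleIndex β ω - 1))
    linarith
  · exact Set.eq_univ_of_forall fun ω => Set.mem_iUnion.2 ⟨_, (h ω _).2 le_rfl⟩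

theorem strictMono_whittleIndex (a : Arm) {β : ℝ} (hβ0 : 0 ≤ β) (hβ1 : β < 1) :
    StrictMono (a.whittleIndex β) := by
  intro x y hxy
  have hx := a.whittleIndex_spec hβ0 hβ1 x
  have hy := a.whittleIndex_spec hβ0 hβ1 y
  rcases eq_or_lt_of_le (unitInterval.le_one' : y ≤ 1) with rfl | hy1
  · have h1 := hy.1
    rw [advantage_one] at h1
    have := (a.subsidy_mem_of_advantage_eq_zero hβ0 hβ1 hx.1 hxy).2
    linarith
  · have hpos := (a.isThreshold_of_advantage_eq_zero hβ0 hβ1 hy.1 hy1).strict x hxy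
    refine lt_of_le_of_ne ((hx.2 _).1 (sub_nonneg.1 hpos.le)) fun heq => ?_
    rw [← heq, hx.1] at hpos
    exact hpos.false

/-! ### The index as a function of a real variable -/

theorem monotone_whittleIndexReal (a : Arm) {β : ℝ} (hβ0 : 0 ≤ β) (hβ1 : β < 1) :
    Monotone (a.whittleIndexReal β) := fun _ _ h =>
  (a.strictMono_whittleIndex hβ0 hβ1).monotone (Set.monotone_projIcc zero_le_one h)

theorem isThreshold_whittleIndexReal (a : Arm) {β : ℝ} (hβ0 : 0 ≤ β) (hβ1 : β < 1) {x : ℝ}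
    (h0 : 0 ≤ x) (h1 : x < 1) : a.IsThreshold β (a.whittleIndexReal β x) ⟨x, h0, h1.le⟩ := by
  rw [whittleIndexReal, Set.projIcc_of_mem zero_le_one ⟨h0, h1.le⟩]
  exact a.isThreshold_of_advantage_eq_zero hβ0 hβ1 (a.whittleIndex_spec hβ0 hβ1 _).1 h1

theorem whittleIndexReal_one (a : Arm) {β : ℝ} (hβ0 : 0 ≤ β) (hβ1 : β < 1) :
    a.whittleIndexReal β 1 = a.B := by
  have h := (a.whittleIndex_spec hβ0 hβ1 1).1
  rw [advantage_one] at h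
  rw [whittleIndexReal, Set.projIcc_right]
  exact sub_eq_zero.1 h

theorem whittleIndexReal_of_le (a : Arm) {β : ℝ} (hβ0 : 0 ≤ β) (hβ1 : β < 1) {x : ℝ}
    (h : 0 ≤ x) (h1 : x ≤ a.p11) (h0 : x ≤ a.p01) : a.whittleIndexReal β x = a.B * x := by
  rcases (h1.trans a.p11.2.2).eq_or_lt with rfl | hx
  · rw [whittleIndexReal_one a hβ0 hβ1, mul_one]
  · rw [mul_comm]
    exact (a.isThreshold_whittleIndexReal hβ0 hβ1 h hx).subsidy_of_le h1 h0

theorem whittleIndexReal_of_ge (a : Arm) {β : ℝ} (hβ0 : 0 ≤ β) (hβ1 : β < 1) {x : ℝ}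
    (h : x ≤ 1) (h1 : a.p11 ≤ x) (h0 : a.p01 ≤ x) : a.whittleIndexReal β x = a.B * x := by
  rcases h.eq_or_lt with rfl | hx
  · rw [whittleIndexReal_one a hβ0 hβ1, mul_one]
  · rw [mul_comm]
    exact (a.isThreshold_whittleIndexReal hβ0 hβ1 (a.p11.2.1.trans h1) hx).subsidy_of_ge
      hβ0 hβ1 h1 h0

/-! ### The stationary probability -/

theorem update_le_of_stationary_le (a : Arm) {x : unitInterval} (h : a.stationary ≤ x) :
    (a.update x : ℝ) ≤ x := by
  have h0 := a.p01.2.1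
  have h1 := a.p11.2.2
  rw [coe_update]
  -- A zero denominator forces p01 = 0 and p11 = 1: the update is then the identity, and division by
  -- zero gives `stationary` the value 0.
  rcases (show 0 ≤ (a.p01 : ℝ) + (1 - a.p11) by linarith).eq_or_lt with hD | hD
  · have e0 : (a.p01 : ℝ) = 0 := by linarith
    have e1 : (a.p11 : ℝ) = 1 := by linarith
    rw [e0, e1]
    linarith
  · rw [stationary, div_le_iff₀ hD] at h
    linarith

theorem lt_update_of_lt_stationary (a : Arm) {x : unitInterval} (h : (x : ℝ) < a.stationary) :
    (x : ℝ) < a.update x := by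
  have h0 := a.p01.2.1
  have h1 := a.p11.2.2
  rw [coe_update]
  rcases (show 0 ≤ (a.p01 : ℝ) + (1 - a.p11) by linarith).eq_or_lt with hD | hD
  · rw [stationary, ← hD, div_zero] at h
    exact absurd x.2.1 h.not_ge
  · rw [stationary, lt_div_iff₀ hD] at h
    linarith

theorem stationary_le_one (a : Arm) : a.stationary ≤ 1 := by
  have h0 := a.p01.2.1
  have h1 := a.p11.2.2
  exact div_le_one_of_le₀ (by linarith) (by linarith)

theorem stationary_nonneg (a : Arm) : 0 ≤ a.stationary :=
  div_nonneg a.p01.2.1 (by linarith [a.p01.2.1, a.p11.2.2])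

theorem stationary_le_p11 (a : Arm) (hp : (a.p01 : ℝ) ≤ a.p11) : a.stationary ≤ a.p11 := by
  by_contra! h
  have := a.lt_update_of_lt_stationary h
  rw [coe_update] at this
  nlinarith [a.p11.2.2]

theorem p11_lt_stationary (a : Arm) (hp : (a.p11 : ℝ) < a.p01) : (a.p11 : ℝ) < a.stationary := by
  have h0 := a.p11.2.1
  have h1 := a.p01.2.2
  rw [stationary, lt_div_iff₀ (by linarith)]
  nlinarith

/-- The update is decreasing and fixes ω_o, and p11 lies below ω_o. -/
theorem stationary_le_update_p11 (a : Arm) (hp : (a.p11 : ℝ) < a.p01) :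
    a.stationary ≤ a.update a.p11 := by
  have h0 := a.p11.2.1
  have h1 := a.p01.2.2
  rw [stationary, div_le_iff₀ (by linarith), coe_update]
  have : 0 ≤ ((a.p01 : ℝ) - a.p11) * (a.p01 - a.p11 * (a.p01 + (1 - a.p11))) :=
    mul_nonneg (by linarith) (by nlinarith)
  nlinarith

theorem update_p11_le (a : Arm) (hp : (a.p11 : ℝ) ≤ a.p01) : (a.update a.p11 : ℝ) ≤ a.p01 := by
  rw [coe_update]
  nlinarith [a.p11.2.1]

theorem le_update_p11 (a : Arm) (hp : (a.p11 : ℝ) ≤ a.p01) : (a.p11 : ℝ) ≤ a.update a.p11 := by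
  rw [coe_update]
  nlinarith [a.p11.2.2]

end Arm

/-! ### Linear fractional functions -/

/-- With z = t x + s y and t + s = 1, the defining equation gives (f z - t f x - s f y)(c + d z) = t
s d (x - y)(f x - f y). Monotonicity fixes the sign of the last two factors, so no condition on a
and b is needed. -/
theorem concaveOn_of_mul_eq {f : ℝ → ℝ} (hf : Monotone f) {S : Set ℝ} (hS : Convex ℝ S)
    {a b c d : ℝ} (hd : 0 ≤ d) (h : ∀ x ∈ S, 0 < c + d * x ∧ f x * (c + d * x) = a + b * x) :
    ConcaveOn ℝ S f := by
  refine ⟨hS, fun x hx y hy t s ht hs hts => ?_⟩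
  obtain ⟨-, ex⟩ := h x hx
  obtain ⟨-, ey⟩ := h y hy
  obtain ⟨pz, ez⟩ := h _ (hS hx hy ht hs hts)
  simp only [smul_eq_mul] at *
  have hprod : 0 ≤ (f x - f y) * (d * (x - y)) := by
    rcases le_total x y with hxy | hxy
    · exact mul_nonneg_of_nonpos_of_nonpos (sub_nonpos.2 (hf hxy))
        (mul_nonpos_of_nonneg_of_nonpos hd (sub_nonpos.2 hxy))
    · exact mul_nonneg (sub_nonneg.2 (hf hxy)) (mul_nonneg hd (sub_nonneg.2 hxy))
  have hprod := mul_nonneg (mul_nonneg ht hs) hprod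
  refine le_of_mul_le_mul_right ?_ pz
  obtain rfl : s = 1 - t := by linarith
  nlinarith

theorem convexOn_of_mul_eq {f : ℝ → ℝ} (hf : Monotone f) {S : Set ℝ} (hS : Convex ℝ S)
    {a b c d : ℝ} (hd : d ≤ 0) (h : ∀ x ∈ S, 0 < c + d * x ∧ f x * (c + d * x) = a + b * x) :
    ConvexOn ℝ S f := by
  refine ⟨hS, fun x hx y hy t s ht hs hts => ?_⟩
  obtain ⟨-, ex⟩ := h x hx
  obtain ⟨-, ey⟩ := h y hy
  obtain ⟨pz, ez⟩ := h _ (hS hx hy ht hs hts)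
  simp only [smul_eq_mul] at *
  have hprod : (f x - f y) * (d * (x - y)) ≤ 0 := by
    rcases le_total x y with hxy | hxy
    · exact mul_nonpos_of_nonpos_of_nonneg (sub_nonpos.2 (hf hxy))
        (mul_nonneg_of_nonpos_of_nonpos hd (sub_nonpos.2 hxy))
    · exact mul_nonpos_of_nonneg_of_nonpos (sub_nonneg.2 (hf hxy))
        (mul_nonpos_of_nonpos_of_nonneg hd (sub_nonneg.2 hxy))
  have hprod := mul_nonpos_of_nonneg_of_nonpos (mul_nonneg ht hs) hprod
  refine le_of_mul_le_mul_right ?_ pz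
  obtain rfl : s = 1 - t := by linarith
  nlinarith

theorem concaveOn_of_eq_mul {f : ℝ → ℝ} {S : Set ℝ} (hS : Convex ℝ S) {c : ℝ}
    (h : ∀ x ∈ S, f x = c * x) : ConcaveOn ℝ S f := by
  refine ⟨hS, fun x hx y hy t s ht hs hts => ?_⟩
  rw [h x hx, h y hy, h _ (hS hx hy ht hs hts)]
  simp only [smul_eq_mul]
  linarith

theorem convexOn_of_eq_mul {f : ℝ → ℝ} {S : Set ℝ} (hS : Convex ℝ S) {c : ℝ}
    (h : ∀ x ∈ S, f x = c * x) : ConvexOn ℝ S f := by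
  refine ⟨hS, fun x hx y hy t s ht hs hts => ?_⟩
  rw [h x hx, h y hy, h _ (hS hx hy ht hs hts)]
  simp only [smul_eq_mul]
  linarith

/-! ### Piecewise concave and convex functions -/

theorem pairwiseDisjoint_union_of_disjoint {P Q : Set (Set ℝ)} (hP : P.PairwiseDisjoint id)
    (hQ : Q.PairwiseDisjoint id) (h : Disjoint (⋃₀ P) (⋃₀ Q)) : (P ∪ Q).PairwiseDisjoint id :=
  Set.pairwiseDisjoint_union.2 ⟨hP, hQ, fun _ hi _ hj _ =>
    h.mono (Set.subset_sUnion_of_mem hi) (Set.subset_sUnion_of_mem hj)⟩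

theorem ConcaveOn.piecewise {f : ℝ → ℝ} {s : Set ℝ} (h : ConcaveOn ℝ s f) :
    PiecewiseConcaveOnCountable f s :=
  ⟨{s}, Set.countable_singleton s, Set.pairwiseDisjoint_singleton _ _, Set.sUnion_singleton s,
    by rintro _ rfl; exact h⟩

theorem PiecewiseConcaveOnCountable.union {f : ℝ → ℝ} {s t : Set ℝ}
    (hs : PiecewiseConcaveOnCountable f s) (ht : PiecewiseConcaveOnCountable f t)
    (hst : Disjoint s t) : PiecewiseConcaveOnCountable f (s ∪ t) := by
  obtain ⟨P, hPc, hPd, rfl, hP⟩ := hs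
  obtain ⟨Q, hQc, hQd, rfl, hQ⟩ := ht
  exact ⟨P ∪ Q, hPc.union hQc, pairwiseDisjoint_union_of_disjoint hPd hQd hst, Set.sUnion_union P Q,
    fun J hJ => hJ.elim (hP J) (hQ J)⟩

theorem ConvexOn.piecewise {f : ℝ → ℝ} {s : Set ℝ} (h : ConvexOn ℝ s f) :
    PiecewiseConvexOnFinite f s :=
  ⟨{s}, Set.finite_singleton s, Set.pairwiseDisjoint_singleton _ _, Set.sUnion_singleton s,
    by rintro _ rfl; exact h⟩

theorem PiecewiseConvexOnFinite.union {f : ℝ → ℝ} {s t : Set ℝ}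
    (hs : PiecewiseConvexOnFinite f s) (ht : PiecewiseConvexOnFinite f t)
    (hst : Disjoint s t) : PiecewiseConvexOnFinite f (s ∪ t) := by
  obtain ⟨P, hPc, hPd, rfl, hP⟩ := hs
  obtain ⟨Q, hQc, hQd, rfl, hQ⟩ := ht
  exact ⟨P ∪ Q, hPc.union hQc, pairwiseDisjoint_union_of_disjoint hPd hQd hst, Set.sUnion_union P Q,
    fun J hJ => hJ.elim (hP J) (hQ J)⟩

/-! ### Top sets and maximal sums -/

/-- Exchange argument. Two K-sets differ by parts of equal size, separated by the least value on U \
U'; conversely, swapping i for j cannot raise a maximal sum. -/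
theorem isTopSet_iff_maximal_sum {N K : ℕ} (v : Fin N → ℝ) (U : Finset (Fin N)) :
    IsTopSet K v U ↔ U.card = K ∧
      ∀ U' : Finset (Fin N), U'.card = K → ∑ i ∈ U', v i ≤ ∑ i ∈ U, v i := by
  refine and_congr_right fun hU => ⟨fun h U' hU' => ?_, fun h i hi j hj => ?_⟩
  · rw [← Finset.sum_sdiff_le_sum_sdiff]
    have hcard : (U' \ U).card = (U \ U').card :=
      Finset.card_sdiff_comm (hU'.trans hU.symm)
    rcases (U \ U').eq_empty_or_nonempty with he | hne
    · rw [he, Finset.card_empty, Finset.card_eq_zero] at hcard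
      rw [he, hcard]
    · obtain ⟨i, hi, hmin⟩ := Finset.exists_min_image (U \ U') v hne
      calc ∑ j ∈ U' \ U, v j ≤ (U' \ U).card • v i :=
            Finset.sum_le_card_nsmul _ _ _ fun j hj =>
              h i (Finset.mem_sdiff.1 hi).1 j (Finset.mem_sdiff.1 hj).2
        _ = (U \ U').card • v i := by rw [hcard]
        _ ≤ ∑ j ∈ U \ U', v j := Finset.card_nsmul_le_sum _ _ _ hmin
  · have hj' : j ∉ U.erase i := fun h => hj (Finset.mem_of_mem_erase h)
    have := h (insert j (U.erase i)) (by
      rw [Finset.card_insert_of_notMem hj', Finset.card_erase_of_mem hi, hU]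
      have := Finset.card_pos.2 ⟨i, hi⟩
      omega)
    rw [Finset.sum_insert hj', ← Finset.add_sum_erase U v hi] at this
    linarith

/-! ### Concavity and convexity of the index, region by region -/

namespace Arm

theorem concaveOn_stationary_p11 (a : Arm) {β : ℝ} (hβ0 : 0 ≤ β) (hβ1 : β < 1)
    (hp : (a.p01 : ℝ) ≤ a.p11) :
    ConcaveOn ℝ (Set.Ico a.stationary (a.p11 : ℝ)) (a.whittleIndexReal β) := by
  refine concaveOn_of_mul_eq (a.monotone_whittleIndexReal hβ0 hβ1) (convex_Ico _ _) (a := 0)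
    (b := a.B) (c := 1 - β * a.p11) (d := β) hβ0 fun x hx => ?_
  have ht := a.isThreshold_whittleIndexReal hβ0 hβ1 (a.stationary_nonneg.trans hx.1)
    (hx.2.trans_le a.p11.2.2)
  obtain ⟨h1, h2⟩ := ht.subsidy_of_update_le hβ0 hβ1 hp (a.update_le_of_stationary_le hx.1) hx.2.le
  exact ⟨h1, h2.trans (by ring)⟩

theorem piecewiseConcave_p01_stationary (a : Arm) {β : ℝ} (hβ0 : 0 ≤ β) (hβ1 : β < 1)
    (hp : (a.p01 : ℝ) ≤ a.p11) :
    PiecewiseConcaveOnCountable (a.whittleIndexReal β) (Set.Ioo (a.p01 : ℝ) a.stationary) := by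
  have hmono : Monotone a.update := fun x y hxy => by
    have hxy' : (x : ℝ) ≤ y := hxy
    change (a.update x : ℝ) ≤ a.update y
    rw [coe_update, coe_update]
    nlinarith
  have h0 : a.p01 ≤ a.update a.p01 := by
    rw [← update_zero]
    exact hmono bot_le
  let g : ℕ → ℝ := fun k => (a.update^[k] a.p01 : ℝ)
  have hg : Monotone g := hmono.monotone_iterate_of_le_map h0
  -- Piece k collects the thresholds that the passive orbit of p01 first exceeds at step k + 1. The
  -- intersection drops p01 itself, the left end of piece 0.
  let J : ℕ → Set ℝ := fun k => Set.Ico (g k) (g (k + 1)) ∩ Set.Ioo (a.p01 : ℝ) a.stationary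
  refine ⟨Set.range J, Set.countable_range J, ?_, ?_, ?_⟩
  · rintro _ ⟨i, rfl⟩ _ ⟨j, rfl⟩ hij
    have hne : i ≠ j := fun h => hij (h ▸ rfl)
    exact (hg.pairwise_disjoint_on_Ico_succ hne).mono Set.inter_subset_left Set.inter_subset_left
  · ext x
    simp only [Set.sUnion_range, Set.mem_iUnion]
    refine ⟨fun ⟨k, hk⟩ => hk.2, fun hx => ?_⟩
    have hx0 : 0 ≤ x := a.p01.2.1.trans hx.1.le
    have hx1 : x ≤ 1 := hx.2.le.trans a.stationary_le_one
    obtain ⟨k, hk, hk'⟩ := a.exists_iterate_update_le_lt (ω := ⟨x, hx0, hx1⟩) hx.1.le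
      (a.lt_update_of_lt_stationary hx.2)
    exact ⟨k, ⟨hk, hk'⟩, hx⟩
  · rintro _ ⟨k, rfl⟩
    have hA : 0 ≤ β * (1 - β ^ (k + 1)) / (1 - β) :=
      div_nonneg (mul_nonneg hβ0 (sub_nonneg.2 (pow_le_one₀ hβ0 hβ1.le))) (by linarith)
    have hΔ : 0 ≤ 1 - β * ((a.p11 : ℝ) - a.p01) := by
      nlinarith [a.p11.2.2, a.p01.2.1]
    refine concaveOn_of_mul_eq (a.monotone_whittleIndexReal hβ0 hβ1)
      ((convex_Ico _ _).inter (convex_Ioo _ _))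
      (a := a.B * (-(1 + β * (1 - β ^ (k + 1)) / (1 - β)) * (β * a.p01) + β ^ (k + 2) * g (k + 1)))
      (b := a.B * ((1 + β * (1 - β ^ (k + 1)) / (1 - β)) * (1 - β * ((a.p11 : ℝ) - a.p01))))
      (c := 1 - β * a.p11 - β * (1 - β ^ (k + 1)) / (1 - β) * (β * a.p01) + β ^ (k + 2) * g (k + 1))
      (mul_nonneg hA hΔ) fun x hx => ?_
    obtain ⟨⟨hk, hk'⟩, hx⟩ := hx
    have ht := a.isThreshold_whittleIndexReal hβ0 hβ1 (a.p01.2.1.trans hx.1.le)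
      (hx.2.trans_le a.stationary_le_one)
    obtain ⟨h1, h2⟩ := ht.subsidy_of_lt_update hβ0 hβ1 hp
      (a.lt_update_of_lt_stationary hx.2).le (k := k) hk hk'.le
    simp only [g]
    refine ⟨h1.trans_eq (by ring), ?_⟩
    linear_combination h2

theorem piecewiseConcave_whittleIndexReal (a : Arm) {β : ℝ} (hβ0 : 0 ≤ β) (hβ1 : β < 1)
    (hp : (a.p01 : ℝ) ≤ a.p11) :
    PiecewiseConcaveOnCountable (a.whittleIndexReal β) (Set.Icc 0 1) := by
  have hs := a.stationary_le_p11 hp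
  have h1 : PiecewiseConcaveOnCountable (a.whittleIndexReal β) (Set.Icc 0 (a.p01 : ℝ)) :=
    (concaveOn_of_eq_mul (convex_Icc _ _) fun x hx =>
      a.whittleIndexReal_of_le hβ0 hβ1 hx.1 (hx.2.trans hp) hx.2).piecewise
  have h2 := a.piecewiseConcave_p01_stationary hβ0 hβ1 hp
  -- The cut at p01 keeps the pieces disjoint when ω_o = p01, as for p01 = 0 or p11 = p01; the last
  -- piece needs it when p11 = p01.
  have h3 : PiecewiseConcaveOnCountable (a.whittleIndexReal β)
      (Set.Ico a.stationary (a.p11 : ℝ) ∩ Set.Ioi (a.p01 : ℝ)) :=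
    ((a.concaveOn_stationary_p11 hβ0 hβ1 hp).subset Set.inter_subset_left
      ((convex_Ico _ _).inter (convex_Ioi _))).piecewise
  have h4 : PiecewiseConcaveOnCountable (a.whittleIndexReal β)
      (Set.Icc (a.p11 : ℝ) 1 ∩ Set.Ioi (a.p01 : ℝ)) :=
    (concaveOn_of_eq_mul ((convex_Icc _ _).inter (convex_Ioi _)) fun x hx =>
      a.whittleIndexReal_of_ge hβ0 hβ1 hx.1.2 hx.1.1 (hp.trans hx.1.1)).piecewise
  have h := ((h1.union h2 ?_).union h3 ?_).union h4 ?_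
  · convert h using 1
    ext x
    have e0 := a.p01.2.1
    have e1 := a.p11.2.2
    simp only [Set.mem_union, Set.mem_inter_iff, Set.mem_Icc, Set.mem_Ioo, Set.mem_Ico, Set.mem_Ioi]
    grind
  all_goals
    rw [Set.disjoint_left]
    intro x
    simp only [Set.mem_union, Set.mem_inter_iff, Set.mem_Icc, Set.mem_Ioo, Set.mem_Ico, Set.mem_Ioi]
    grind

theorem convexOn_p11_stationary (a : Arm) {β : ℝ} (hβ0 : 0 ≤ β) (hβ1 : β < 1)
    (hp : (a.p11 : ℝ) < a.p01) :
    ConvexOn ℝ (Set.Ioo (a.p11 : ℝ) a.stationary) (a.whittleIndexReal β) := by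
  have hΔ : 0 ≤ 1 - β * ((a.p11 : ℝ) - a.p01) := by nlinarith
  refine convexOn_of_mul_eq (a.monotone_whittleIndexReal hβ0 hβ1) (convex_Ioo _ _) (a := 0)
    (b := a.B * (1 - β * ((a.p11 : ℝ) - a.p01)))
    (c := 1 + β * (1 + β) * a.p01 - β ^ 2 * a.update a.p11)
    (d := -(β * (1 - β * ((a.p11 : ℝ) - a.p01)))) (neg_nonpos.2 (mul_nonneg hβ0 hΔ)) fun x hx => ?_
  have ht := a.isThreshold_whittleIndexReal hβ0 hβ1 (a.p11.2.1.trans hx.1.le)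
    (hx.2.trans_le a.stationary_le_one)
  obtain ⟨h1, h2⟩ := ht.subsidy_of_lt_update' hβ0 hβ1 hp
    (a.lt_update_of_lt_stationary hx.2).le hx.1.le
  exact ⟨h1.trans_eq (by ring), by linear_combination h2⟩

theorem convexOn_stationary_update (a : Arm) {β : ℝ} (hβ0 : 0 ≤ β) (hβ1 : β < 1)
    (hp : (a.p11 : ℝ) < a.p01) :
    ConvexOn ℝ (Set.Ico a.stationary (a.update a.p11 : ℝ)) (a.whittleIndexReal β) := by
  refine convexOn_of_mul_eq (a.monotone_whittleIndexReal hβ0 hβ1) (convex_Ico _ _)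
    (a := a.B * (β * a.p01)) (b := a.B * (1 - β))
    (c := 1 + β * (1 + β) * a.p01 - β ^ 2 * a.update a.p11 - β * (β * a.p01))
    (d := -(β * (1 - β))) (neg_nonpos.2 (mul_nonneg hβ0 (by linarith))) fun x hx => ?_
  have ht := a.isThreshold_whittleIndexReal hβ0 hβ1 (a.stationary_nonneg.trans hx.1)
    (hx.2.trans_le (a.update a.p11).2.2)
  obtain ⟨h1, h2⟩ := ht.subsidy_of_update_le_of_le_update hβ0 hβ1 hp
    (a.update_le_of_stationary_le hx.1) hx.2.le
  exact ⟨h1.trans_eq (by ring), by linear_combination h2⟩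

theorem convexOn_update_p01 (a : Arm) {β : ℝ} (hβ0 : 0 ≤ β) (hβ1 : β < 1)
    (hp : (a.p11 : ℝ) < a.p01) :
    ConvexOn ℝ (Set.Ico (a.update a.p11 : ℝ) (a.p01 : ℝ)) (a.whittleIndexReal β) := by
  refine convexOn_of_mul_eq (a.monotone_whittleIndexReal hβ0 hβ1) (convex_Ico _ _)
    (a := a.B * (β * a.p01)) (b := a.B * (1 - β)) (c := 1 + β * a.p01) (d := -β)
    (neg_nonpos.2 hβ0) fun x hx => ?_
  have hx1 := (a.le_update_p11 hp.le).trans hx.1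
  have ht := a.isThreshold_whittleIndexReal hβ0 hβ1 (a.p11.2.1.trans hx1)
    (hx.2.trans_le a.p01.2.2)
  obtain ⟨h1, h2⟩ := ht.subsidy_of_update_le' hβ0 hβ1 hp hx1 hx.1 hx.2.le
  exact ⟨h1.trans_eq (by ring), by linear_combination h2⟩

theorem piecewiseConvex_whittleIndexReal (a : Arm) {β : ℝ} (hβ0 : 0 ≤ β) (hβ1 : β < 1)
    (hp : (a.p11 : ℝ) < a.p01) :
    PiecewiseConvexOnFinite (a.whittleIndexReal β) (Set.Icc 0 1) := by
  have hs := a.p11_lt_stationary hp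
  have hs' := a.stationary_le_update_p11 hp
  have hy := a.update_p11_le hp.le
  have h1 : PiecewiseConvexOnFinite (a.whittleIndexReal β) (Set.Icc 0 (a.p11 : ℝ)) :=
    (convexOn_of_eq_mul (convex_Icc _ _) fun x hx =>
      a.whittleIndexReal_of_le hβ0 hβ1 hx.1 hx.2 (hx.2.trans hp.le)).piecewise
  have h5 : PiecewiseConvexOnFinite (a.whittleIndexReal β) (Set.Icc (a.p01 : ℝ) 1) :=
    (convexOn_of_eq_mul (convex_Icc _ _) fun x hx =>
      a.whittleIndexReal_of_ge hβ0 hβ1 hx.2 (hp.le.trans hx.1) hx.1).piecewise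
  have h2 := (a.convexOn_p11_stationary hβ0 hβ1 hp).piecewise
  have h3 := (a.convexOn_stationary_update hβ0 hβ1 hp).piecewise
  have h4 := (a.convexOn_update_p01 hβ0 hβ1 hp).piecewise
  have h := (((h1.union h2 ?_).union h3 ?_).union h4 ?_).union h5 ?_
  · convert h using 1
    ext x
    have e0 := a.p11.2.1
    have e1 := a.p01.2.2
    simp only [Set.mem_union, Set.mem_Icc, Set.mem_Ioo, Set.mem_Ico]
    grind
  all_goals
    rw [Set.disjoint_left]
    intro x
    simp only [Set.mem_union, Set.mem_Icc, Set.mem_Ioo, Set.mem_Ico]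
    grind

end Arm

/-! ### Equivalence of Whittle's policy and the myopic policy -/

theorem isWhittlePolicy_iff_isMyopicPolicy {β : ℝ} (hβ0 : 0 ≤ β) (hβ1 : β < 1) {N K : ℕ}
    (arms : Fin N → Arm) (h : ∀ i j, arms i = arms j)
    (π : (Fin N → unitInterval) → Finset (Fin N)) :
    IsWhittlePolicy arms K β π ↔ IsMyopicPolicy arms K π := by
  refine forall_congr' fun Ω => ?_
  -- Now both conditions are top-set conditions. Identical arms share one strictly increasing index
  -- and one rate B > 0, so both rank the arms by belief, ties included.
  rw [← isTopSet_iff_maximal_sum fun i => (Ω i : ℝ) * (arms i).B]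
  refine and_congr_right fun _ => forall₄_congr fun i _ j _ => ?_
  beta_reduce
  rw [h j i, ((arms i).strictMono_whittleIndex hβ0 hβ1).le_iff_le,
    mul_le_mul_iff_left₀ (arms i).B_pos]
  rfl

end

theorem corollary1 (β : ℝ) (hβ0 : 0 ≤ β) (hβ1 : β < 1) :
    (∀ a : Arm, a.Indexable β ∧ StrictMono (a.whittleIndex β)) ∧
    (∀ (N K : ℕ) (arms : Fin N → Arm), K ≤ N → (∀ i j, arms i = arms j) →
      ∀ π : (Fin N → unitInterval) → Finset (Fin N),
        IsWhittlePolicy arms K β π ↔ IsMyopicPolicy arms K π) ∧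
    (∀ a : Arm, (a.p01 : ℝ) ≤ (a.p11 : ℝ) →
      PiecewiseConcaveOnCountable (a.whittleIndexReal β) (Set.Icc 0 1) ∧
      LinearOnSet (a.whittleIndexReal β) (Set.Icc 0 (a.p01 : ℝ)) ∧
      LinearOnSet (a.whittleIndexReal β) (Set.Icc (a.p11 : ℝ) 1) ∧
      ConcaveOn ℝ (Set.Ico a.stationary (a.p11 : ℝ)) (a.whittleIndexReal β) ∧
      PiecewiseConcaveOnCountable (a.whittleIndexReal β) (Set.Ioo (a.p01 : ℝ) a.stationary)) ∧
    (∀ a : Arm, (a.p11 : ℝ) < a.p01 →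
      PiecewiseConvexOnFinite (a.whittleIndexReal β) (Set.Icc 0 1) ∧
      LinearOnSet (a.whittleIndexReal β) (Set.Icc 0 (a.p11 : ℝ)) ∧
      LinearOnSet (a.whittleIndexReal β) (Set.Icc (a.p01 : ℝ) 1) ∧
      ConvexOn ℝ (Set.Ioo (a.p11 : ℝ) a.stationary) (a.whittleIndexReal β) ∧
      ConvexOn ℝ (Set.Ico a.stationary (a.update a.p11 : ℝ)) (a.whittleIndexReal β) ∧
      ConvexOn ℝ (Set.Ico (a.update a.p11 : ℝ) (a.p01 : ℝ)) (a.whittleIndexReal β)) := by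
  refine ⟨fun a => ⟨a.indexable hβ0 hβ1, a.strictMono_whittleIndex hβ0 hβ1⟩,
    fun N K arms _ h π => isWhittlePolicy_iff_isMyopicPolicy hβ0 hβ1 arms h π,
    fun a hp => ⟨a.piecewiseConcave_whittleIndexReal hβ0 hβ1 hp,
      ⟨a.B, fun x hx => a.whittleIndexReal_of_le hβ0 hβ1 hx.1 (hx.2.trans hp) hx.2⟩,
      ⟨a.B, fun x hx => a.whittleIndexReal_of_ge hβ0 hβ1 hx.2 hx.1 (hp.trans hx.1)⟩,
      a.concaveOn_stationary_p11 hβ0 hβ1 hp, a.piecewiseConcave_p01_stationary hβ0 hβ1 hp⟩,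
    fun a hp => ⟨a.piecewiseConvex_whittleIndexReal hβ0 hβ1 hp,
      ⟨a.B, fun x hx => a.whittleIndexReal_of_le hβ0 hβ1 hx.1 hx.2 (hx.2.trans hp.le)⟩,
      ⟨a.B, fun x hx => a.whittleIndexReal_of_ge hβ0 hβ1 hx.2 (hp.le.trans hx.1) hx.1⟩,
      a.convexOn_p11_stationary hβ0 hβ1 hp, a.convexOn_stationary_update hβ0 hβ1 hp,
      a.convexOn_update_p01 hβ0 hβ1 hp⟩⟩
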